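/- A *prop* $P$ consists of sets $P[n,m]$ of morphisms $n\to m$ for $n,m\in\mathbb N$, associative compositions $\circ:P[b,c]\times P[a,b]\to P[a,c]$, associative tensor products $\otimes:P[a,b]\times P[c,d]\to P[a+c,b+d]$ with $(f\circ g)\otimes(h\circ k)=(f\otimes h)\circ(g\otimes k)$, an empty morphism $1:0\to0$ with $f\otimes 1=1\otimes f=f$, an identity $\mathrm{id}:1\to1$ with $f\circ \mathrm{id}^{\otimes a}=\mathrm{id}^{\otimes b}\circ f=f$ for $f:a\to b$ (where $\mathrm{id}^{\otimes0}=1$), and a symmetry $\sigma:2\to2$ with $\sigma\circ\sigma=\mathrm{id}^{\otimes2}$ and $\sigma_b\circ(\mathrm{id}\otimes f)=(f\otimes\mathrm{id})\circ\sigma_a$ for all $f:a\to b$, where $\sigma_0=\mathrm{id}$ and $\sigma_{n+1}=(\mathrm{id}^{\otimes n}\otimes\sigma)\circ(\sigma_n\otimes\mathrm{id})$. (Equivalently, a prop is a strict symmetric monoidal category with monoid of objects $(\mathbb N,+)$.) A *prop functor* $P\to Q$ is a family of maps $P[n,m]\to Q[n,m]$ preserving $\circ$, $\otimes$, $1$,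 $\mathrm{id}$ and $\sigma$; an isomorphism of props is a prop functor with an inverse prop functor. A prop $P$ with chosen morphisms interpreting a set of generators is *presented* by these generators and a set of equations if the chosen morphisms satisfy the equations and, for every prop $Q$ with chosen morphisms satisfying the equations, there is a unique prop functor $P\to Q$ sending generators to generators. Consider the generators $\mu:2\to1$, $\eta:0\to1$, $\Delta:1\to2$, $\epsilon:1\to0$, $h:1\to1$ and the equations $$\mu\circ(\eta\otimes\mathrm{id})=\mu\circ(\mathrm{id}\otimes\eta)=\mathrm{id},\quad \mu\circ(\mu\otimes\mathrm{id})=\mu\circ(\mathrm{id}\otimes\mu),\quad \mu\circ\sigma=\mu,$$ $$(\epsilon\otimes\mathrm{id})\circ\Delta=(\mathrm{id}\otimes\epsilon)\circ\Delta=\mathrm{id},\quad (\Delta\otimes\mathrm{id})\circ\Delta=(\mathrm{id}\otimes\Delta)\circ\Delta,\quad \sigma\circ\Delta=\Delta,$$ $$\Delta\circ\eta=\eta\otimes\eta,\quad \epsilon\circ\mu=\epsilon\otimes\epsilon,\quad \epsilon\circ\eta=1,\quad (\mu\otimes\mu)\circ(\mathrm{id}\otimes\sigma\otimes\mathrm{id})\circ(\Delta\otimes\Delta)=\Delta\circ\mu,$$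 $$h\circ\mu=\mu\circ(h\otimes h),\quad h\circ\eta=\eta,\quad (h\otimes h)\circ\Delta=\Delta\circ h,\quad \epsilon\circ h=\epsilon .$$ Let $M_{\star,\star}(\mathbb Z_+[t])$ be the prop whose morphisms $n\to m$ are the $m\times n$ matrices with entries in the semiring $\mathbb Z_+[t]$ of polynomials with nonnegative integer coefficients, where $\circ$ is the matrix product, $A\otimes B=\begin{pmatrix}A&0\\0&B\end{pmatrix}$, $1$ and $\mathrm{id}$ are the identity matrices of sizes $0$ and $1$, and $\sigma=\begin{pmatrix}0&1\\1&0\end{pmatrix}$. **Proposition.** The prop $M_{\star,\star}(\mathbb Z_+[t])$, with $\mu=\begin{pmatrix}1&1\end{pmatrix}$, $\Delta=\begin{pmatrix}1\\1\end{pmatrix}$, $h=\begin{pmatrix}t\end{pmatrix}$, and with $\eta$ and $\epsilon$ the unique matrices of sizes $1\times0$ and $0\times1$, is presented by these generators and equations. Consequently every prop presented by these generators and equations is isomorphic to $M_{\star,\star}(\mathbb Z_+[t])$, by an isomorphism of props that sends the generators to the matrices above. -/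

import Mathlib

universe u v w

/-- The operations of a prop: `Hom n m` is the set of morphisms `n → m`, `comp f g` is `f ∘ g`,
`tensor f g` is `f ⊗ g`, `one : 0 → 0` is the empty morphism, `id : 1 → 1` the identity wire and
`sym : 2 → 2` the symmetry. -/
structure PropOps where
  Hom : ℕ → ℕ → Type u
  comp : {a b c : ℕ} → Hom b c → Hom a b → Hom a c
  tensor : {a b c d : ℕ} → Hom a b → Hom c d → Hom (a + c) (b + d)
  one : Hom 0 0
  id : Hom 1 1
  sym : Hom 2 2

namespace PropOps

variable (P : PropOps.{u})

/-- Transport of a morphism along equalities of natural numbers. -/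
def cast {a b a' b' : ℕ} (ha : a = a') (hb : b = b') (f : P.Hom a b) : P.Hom a' b' :=
  hb ▸ ha ▸ f

/-- `id^{⊗ n}`, with `id^{⊗ 0} = 1`. -/
def idPow : (n : ℕ) → P.Hom n n
  | 0 => P.one
  | n + 1 => P.tensor (idPow n) P.id

/-- The symmetry `1 + n → n + 1` that moves the first wire past the `n` others:
`σ_0 = id` and `σ_{n+1} = (id^{⊗ n} ⊗ σ) ∘ (σ_n ⊗ id)`. -/
def symPow : (n : ℕ) → P.Hom (n + 1) (n + 1)
  | 0 => P.id
  | n + 1 => P.comp (P.tensor (P.idPow n) P.sym : P.Hom (n + 2) (n + 2))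
      (P.tensor (symPow n) P.id : P.Hom (n + 1 + 1) (n + 1 + 1))

end PropOps

/-- A prop: a strict symmetric monoidal category whose monoid of objects is `(ℕ, +)`. -/
structure PROP extends PropOps.{u} where
  comp_assoc : ∀ {a b c d : ℕ} (f : Hom c d) (g : Hom b c) (h : Hom a b),
    comp (comp f g) h = comp f (comp g h)
  tensor_assoc : ∀ {a b c d m n : ℕ} (f : Hom a b) (g : Hom c d) (h : Hom m n),
    toPropOps.cast (Nat.add_assoc a c m) (Nat.add_assoc b d n) (tensor (tensor f g) h) =
      tensor f (tensor g h)
  comp_tensor_comp : ∀ {a b c a' b' c' : ℕ} (f : Hom b c) (g : Hom a b)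
    (h : Hom b' c') (k : Hom a' b'),
    tensor (comp f g) (comp h k) = comp (tensor f h) (tensor g k)
  tensor_one : ∀ {a b : ℕ} (f : Hom a b), tensor f one = f
  one_tensor : ∀ {a b : ℕ} (f : Hom a b),
    toPropOps.cast (Nat.zero_add a) (Nat.zero_add b) (tensor one f) = f
  comp_idPow : ∀ {a b : ℕ} (f : Hom a b), comp f (toPropOps.idPow a) = f
  idPow_comp : ∀ {a b : ℕ} (f : Hom a b), comp (toPropOps.idPow b) f = f
  sym_comp_sym : comp sym sym = toPropOps.idPow 2
  sym_natural : ∀ {a b : ℕ} (f : Hom a b),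
    comp (toPropOps.symPow b)
        (toPropOps.cast (Nat.add_comm 1 a) (Nat.add_comm 1 b) (tensor id f)) =
      comp (tensor f id) (toPropOps.symPow a)

namespace PROP

/-- A prop functor (morphism of props). -/
structure Functor (P : PROP.{u}) (Q : PROP.{v}) where
  map : {a b : ℕ} → P.Hom a b → Q.Hom a b
  map_comp : ∀ {a b c : ℕ} (f : P.Hom b c) (g : P.Hom a b),
    map (P.comp f g) = Q.comp (map f) (map g)
  map_tensor : ∀ {a b c d : ℕ} (f : P.Hom a b) (g : P.Hom c d),
    map (P.tensor f g) = Q.tensor (map f) (map g)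
  map_one : map P.one = Q.one
  map_id : map P.id = Q.id
  map_sym : map P.sym = Q.sym

/-- An isomorphism of props: a pair of mutually inverse prop functors. -/
structure Iso (P : PROP.{u}) (Q : PROP.{v}) where
  hom : Functor P Q
  inv : Functor Q P
  inv_hom : ∀ {a b : ℕ} (f : P.Hom a b), inv.map (hom.map f) = f
  hom_inv : ∀ {a b : ℕ} (g : Q.Hom a b), hom.map (inv.map g) = g

/-- The expressions (circuits) that can be formed from a family `G` of generators. -/
inductive Expr (G : ℕ → ℕ → Type w) : ℕ → ℕ → Type w
  | gen {a b : ℕ} (g : G a b) : Expr G a b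
  | comp {a b c : ℕ} (f : Expr G b c) (g : Expr G a b) : Expr G a c
  | tensor {a b c d : ℕ} (f : Expr G a b) (g : Expr G c d) : Expr G (a + c) (b + d)
  | one : Expr G 0 0
  | id : Expr G 1 1
  | sym : Expr G 2 2

/-- Generators and equations. -/
structure Presentation where
  Gen : ℕ → ℕ → Type w
  Eqn : {a b : ℕ} → Expr Gen a b → Expr Gen a b → Prop

/-- The value of an expression in a prop, once the generators have been interpreted. -/
def eval {G : ℕ → ℕ → Type w} (P : PROP.{u}) (γ : {a b : ℕ} → G a b → P.Hom a b) :
    {a b : ℕ} → Expr G a b → P.Hom a b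
  | _, _, .gen g => γ g
  | _, _, .comp f g => P.comp (eval P γ f) (eval P γ g)
  | _, _, .tensor f g => P.tensor (eval P γ f) (eval P γ g)
  | _, _, .one => P.one
  | _, _, .id => P.id
  | _, _, .sym => P.sym

/-- A choice of the generators inside `P` that satisfies the equations. -/
structure Model (S : Presentation.{w}) (P : PROP.{u}) where
  gen : {a b : ℕ} → S.Gen a b → P.Hom a b
  eqn : ∀ {a b : ℕ} (s t : Expr S.Gen a b), S.Eqn s t → eval P gen s = eval P gen t

/-- `P`, with the generators chosen by `M`, is a prop presented by `S`: for every prop `Q` that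
contains generators satisfying the equations there is a unique prop functor `P → Q` that sends the
generators to the generators. -/
def IsPresentedBy {S : Presentation.{w}} {P : PROP.{u}} (M : Model S P) : Prop :=
  ∀ (Q : PROP.{v}) (N : Model S Q),
    ∃! F : Functor P Q, ∀ {a b : ℕ} (g : S.Gen a b), F.map (M.gen g) = N.gen g

/-! ### The prop of matrices -/

section Matrices

variable (R : Type u) [Semiring R]

/-- Morphisms `n → m` are `m × n` matrices, composition is the matrix product and `⊗` is the
direct sum of matrices. -/
def matOps : PropOps.{u} where
  Hom n m := Matrix (Fin m) (Fin n) R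
  comp A B := A * B
  tensor A B := Matrix.reindex finSumFinEquiv finSumFinEquiv (Matrix.fromBlocks A 0 0 B)
  one := 1
  id := 1
  sym := !![0, 1; 1, 0]

variable {R}

theorem matOps_tensor_apply {a b c d : ℕ} (A : Matrix (Fin b) (Fin a) R)
    (B : Matrix (Fin d) (Fin c) R) (i : Fin (b + d)) (j : Fin (a + c)) :
    ((matOps R).tensor A B : Matrix (Fin (b + d)) (Fin (a + c)) R) i j =
      if hi : (i : ℕ) < b then
        (if hj : (j : ℕ) < a then A ⟨i, hi⟩ ⟨j, hj⟩ else 0)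
      else (if hj : (j : ℕ) < a then 0 else B ⟨i - b, by omega⟩ ⟨j - a, by omega⟩) := by
  change Matrix.fromBlocks A 0 0 B (finSumFinEquiv.symm i) (finSumFinEquiv.symm j) = _
  induction i using Fin.addCases <;> induction j using Fin.addCases <;> simp

theorem matOps_tensor_one {a b : ℕ} (A : Matrix (Fin b) (Fin a) R) :
    (matOps R).tensor A (1 : Matrix (Fin 0) (Fin 0) R) = A := by
  refine Matrix.ext fun i j => ?_
  refine (matOps_tensor_apply A 1 i j).trans ?_
  have hi : (i : ℕ) < b := i.2
  have hj : (j : ℕ) < a := j.2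
  simp [hi, hj]

theorem matOps_idPow (n : ℕ) :
    (matOps R).idPow n = (1 : Matrix (Fin n) (Fin n) R) := by
  induction n with
  | zero => rfl
  | succ n ih =>
    refine (congrArg (fun M => (matOps R).tensor M (1 : Matrix (Fin 1) (Fin 1) R)) ih).trans ?_
    change Matrix.reindex _ _ (Matrix.fromBlocks 1 0 0 1) = _
    rw [Matrix.fromBlocks_one, Matrix.reindex_apply, Matrix.submatrix_one_equiv]

theorem matOps_comp_tensor_comp {a b c a' b' c' : ℕ} (f : Matrix (Fin c) (Fin b) R)
    (g : Matrix (Fin b) (Fin a) R) (h : Matrix (Fin c') (Fin b') R)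
    (k : Matrix (Fin b') (Fin a') R) :
    Matrix.reindex finSumFinEquiv finSumFinEquiv (Matrix.fromBlocks (f * g) 0 0 (h * k)) =
      Matrix.reindex finSumFinEquiv finSumFinEquiv (Matrix.fromBlocks f 0 0 h) *
      Matrix.reindex finSumFinEquiv finSumFinEquiv (Matrix.fromBlocks g 0 0 k) := by
  simp [Matrix.reindex_apply, Matrix.submatrix_mul_equiv, Matrix.fromBlocks_multiply]

/-- The permutation underlying `σ_n`. -/
def rot (n : ℕ) (i : Fin (n + 1)) : Fin (n + 1) :=
  if h : (i : ℕ) = n then 0 else ⟨i + 1, by omega⟩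

theorem rot_val (n : ℕ) (i : Fin (n + 1)) :
    (rot n i : ℕ) = if (i : ℕ) = n then 0 else (i : ℕ) + 1 := by
  unfold rot; split <;> rfl

theorem matOps_symPow_apply (n : ℕ) (i j : Fin (n + 1)) :
    ((matOps R).symPow n : Matrix (Fin (n + 1)) (Fin (n + 1)) R) i j =
      if rot n i = j then 1 else 0 := by
  induction n with
  | zero =>
    change (1 : Matrix (Fin 1) (Fin 1) R) i j = _
    have h1 : i = j := Fin.ext (by omega)
    have h2 : rot 0 i = j := Fin.ext (by omega)
    rw [if_pos h2, h1, Matrix.one_apply_eq]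
  | succ n ih =>
    let e : Fin (n + 2) → Fin (n + 2) := fun i =>
      if (i : ℕ) = n then ⟨n + 1, by omega⟩ else if (i : ℕ) = n + 1 then ⟨n, by omega⟩ else i
    have he : ∀ i, (e i : ℕ) = if (i : ℕ) = n then n + 1 else if (i : ℕ) = n + 1 then n else i := by
      intro i; simp only [e]; split_ifs <;> rfl
    have hX : ∀ i k : Fin (n + 2),
        ((matOps R).tensor ((matOps R).idPow n) (matOps R).sym :
          Matrix (Fin (n + 2)) (Fin (n + 2)) R) i k = if e i = k then 1 else 0 := by
      intro i k
      refine (matOps_tensor_apply _ (!![0, 1; 1, 0] : Matrix (Fin 2) (Fin 2) R) i k).trans ?_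
      rw [matOps_idPow]
      simp only [Fin.ext_iff, he]
      by_cases hi : (i : ℕ) < n
      · by_cases hk : (k : ℕ) < n
        · simp [hi, hk, Matrix.one_apply, hi.ne, (show (i : ℕ) ≠ n + 1 by omega)]
        · simp [hi, hk, hi.ne, (show (i : ℕ) ≠ n + 1 by omega), (show (i : ℕ) ≠ k by omega)]
      · obtain hi' | hi' : (i : ℕ) = n ∨ (i : ℕ) = n + 1 := by omega
        · obtain hk | hk | hk : (k : ℕ) < n ∨ (k : ℕ) = n ∨ (k : ℕ) = n + 1 := by omega
          · simp [hi', hk, (show n + 1 ≠ (k : ℕ) by omega)]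
          · simp [hi', hk]
          · simp [hi', hk]
        · obtain hk | hk | hk : (k : ℕ) < n ∨ (k : ℕ) = n ∨ (k : ℕ) = n + 1 := by omega
          · simp [hi', hk, (show n ≠ (k : ℕ) by omega)]
          · simp [hi', hk]
          · simp [hi', hk]
    have hY : ∀ k : Fin (n + 2),
        ((matOps R).tensor ((matOps R).symPow n) (matOps R).id :
          Matrix (Fin (n + 1 + 1)) (Fin (n + 1 + 1)) R) k j =
        if (if (k : ℕ) = n then 0 else if (k : ℕ) = n + 1 then n + 1 else (k : ℕ) + 1) = (j : ℕ)
          then 1 else 0 := by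
      intro k
      refine (matOps_tensor_apply _ (1 : Matrix (Fin 1) (Fin 1) R) k j).trans ?_
      by_cases hk : (k : ℕ) < n + 1
      · rw [dif_pos hk, if_neg (show (k : ℕ) ≠ n + 1 by omega)]
        by_cases hj : (j : ℕ) < n + 1
        · rw [dif_pos hj, ih]
          simp [Fin.ext_iff, rot_val]
        · rw [dif_neg hj, if_neg]
          split_ifs <;> omega
      · rw [dif_neg hk, if_neg (show (k : ℕ) ≠ n by omega), if_pos (show (k : ℕ) = n + 1 by omega)]
        by_cases hj : (j : ℕ) < n + 1
        · rw [dif_pos hj, if_neg (by omega)]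
        · rw [dif_neg hj, if_pos (by omega)]
          exact (congrArg₂ (1 : Matrix (Fin 1) (Fin 1) R) (Subsingleton.elim _ _) rfl).trans
            (Matrix.one_apply_eq _)
    refine (Matrix.mul_apply
      (M := ((matOps R).tensor ((matOps R).idPow n) (matOps R).sym :
        Matrix (Fin (n + 2)) (Fin (n + 2)) R))
      (N := ((matOps R).tensor ((matOps R).symPow n) (matOps R).id :
        Matrix (Fin (n + 1 + 1)) (Fin (n + 1 + 1)) R))).trans ?_
    refine (Finset.sum_congr rfl fun k _ => congrArg₂ (· * ·) (hX i k) (hY k)).trans ?_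
    simp only [ite_mul, one_mul, zero_mul, Finset.sum_ite_eq, Finset.mem_univ, if_true]
    simp only [Fin.ext_iff, rot_val, he]
    congr 1
    have := i.2
    apply propext
    split_ifs <;> omega

theorem matOps_cast_apply {a b a' b' : ℕ} (ha : a = a') (hb : b = b')
    (A : Matrix (Fin b) (Fin a) R) (i : Fin b') (j : Fin a') :
    ((matOps R).cast ha hb A : Matrix (Fin b') (Fin a') R) i j =
      A (Fin.cast hb.symm i) (Fin.cast ha.symm j) := by
  subst ha hb
  rfl

theorem matOps_tensor_assoc {a b c d m n : ℕ} (f : Matrix (Fin b) (Fin a) R)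
    (g : Matrix (Fin d) (Fin c) R) (h : Matrix (Fin n) (Fin m) R) :
    (matOps R).cast (Nat.add_assoc a c m) (Nat.add_assoc b d n)
        ((matOps R).tensor ((matOps R).tensor f g) h) =
      (matOps R).tensor f ((matOps R).tensor g h) := by
  refine Matrix.ext fun i j => ?_
  refine (matOps_cast_apply _ _ _ i j).trans ((matOps_tensor_apply ((matOps R).tensor f g) h
    _ _).trans (Eq.trans ?_ (matOps_tensor_apply f ((matOps R).tensor g h) i j).symm))
  have h1 := fun i j => matOps_tensor_apply f g i j
  have h2 := fun i j => matOps_tensor_apply g h i j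
  simp only [h1, h2, Fin.val_cast]
  have hi := i.2
  have hj := j.2
  by_cases c1 : (i : ℕ) < b <;> by_cases c2 : (i : ℕ) - b < d <;>
    by_cases c3 : (j : ℕ) < a <;> by_cases c4 : (j : ℕ) - a < c
  all_goals
    have k1 : (i : ℕ) < b + d ↔ (i : ℕ) < b ∨ (i : ℕ) - b < d := by omega
    have k2 : (j : ℕ) < a + c ↔ (j : ℕ) < a ∨ (j : ℕ) - a < c := by omega
    simp [k1, k2, c1, c2, c3, c4, Nat.sub_sub]

theorem matOps_one_tensor {a b : ℕ} (f : Matrix (Fin b) (Fin a) R) :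
    (matOps R).cast (Nat.zero_add a) (Nat.zero_add b) ((matOps R).tensor (matOps R).one f) = f := by
  refine Matrix.ext fun i j => ?_
  refine (matOps_cast_apply _ _ _ i j).trans
    ((matOps_tensor_apply (1 : Matrix (Fin 0) (Fin 0) R) f _ _).trans ?_)
  simp

/-- The inverse of `rot`. -/
def rotInv (n : ℕ) (i : Fin (n + 1)) : Fin (n + 1) :=
  if h : (i : ℕ) = 0 then ⟨n, by omega⟩ else ⟨i - 1, by omega⟩

theorem rotInv_val (n : ℕ) (i : Fin (n + 1)) :
    (rotInv n i : ℕ) = if (i : ℕ) = 0 then n else (i : ℕ) - 1 := by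
  unfold rotInv; split <;> rfl

theorem rot_eq_iff (n : ℕ) (i j : Fin (n + 1)) : rot n i = j ↔ rotInv n j = i := by
  rw [Fin.ext_iff, Fin.ext_iff, rot_val, rotInv_val]
  have := i.2
  have := j.2
  split_ifs <;> omega

theorem matOps_sym_natural {a b : ℕ} (f : Matrix (Fin b) (Fin a) R) :
    (matOps R).comp ((matOps R).symPow b)
        ((matOps R).cast (Nat.add_comm 1 a) (Nat.add_comm 1 b)
          ((matOps R).tensor (matOps R).id f)) =
      (matOps R).comp ((matOps R).tensor f (matOps R).id) ((matOps R).symPow a) := by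
  refine Matrix.ext fun i j => ?_
  have hL : ∀ k : Fin (b + 1), ((matOps R).cast (Nat.add_comm 1 a) (Nat.add_comm 1 b)
      ((matOps R).tensor (matOps R).id f) : Matrix (Fin (b + 1)) (Fin (a + 1)) R) k j =
      if hi : (k : ℕ) < 1 then (if hj : (j : ℕ) < 1 then 1 else 0)
      else (if hj : (j : ℕ) < 1 then 0 else f ⟨k - 1, by omega⟩ ⟨j - 1, by omega⟩) := by
    intro k
    refine (matOps_cast_apply _ _ _ k j).trans
      ((matOps_tensor_apply (1 : Matrix (Fin 1) (Fin 1) R) f _ _).trans ?_)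
    by_cases c1 : k = 0 <;> by_cases c2 : j = 0 <;> simp [c1, c2, Matrix.one_apply]
  have hR : ∀ k : Fin (a + 1), ((matOps R).tensor f (matOps R).id :
      Matrix (Fin (b + 1)) (Fin (a + 1)) R) i k =
      if hi : (i : ℕ) < b then (if hj : (k : ℕ) < a then f ⟨i, hi⟩ ⟨k, hj⟩ else 0)
      else (if hj : (k : ℕ) < a then 0 else 1) := by
    intro k
    refine (matOps_tensor_apply f (1 : Matrix (Fin 1) (Fin 1) R) i k).trans ?_
    have hi := i.2
    have hk := k.2
    by_cases c1 : (i : ℕ) < b <;> by_cases c2 : (k : ℕ) < a <;> simp [c1, c2, Matrix.one_apply]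
    omega
  refine (Matrix.mul_apply (M := (matOps R).symPow b) (N := (matOps R).cast (Nat.add_comm 1 a)
    (Nat.add_comm 1 b) ((matOps R).tensor (matOps R).id f))).trans ?_
  refine Eq.trans ?_ (Matrix.mul_apply
    (M := ((matOps R).tensor f (matOps R).id : Matrix (Fin (b + 1)) (Fin (a + 1)) R))
    (N := (matOps R).symPow a)).symm
  refine (Finset.sum_congr rfl fun k _ =>
    congrArg₂ (· * ·) (matOps_symPow_apply b i k) (hL k)).trans ?_
  refine Eq.trans ?_ (Finset.sum_congr rfl fun k _ =>
    congrArg₂ (· * ·) (hR k) (matOps_symPow_apply a k j)).symm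
  simp only [rot_eq_iff a, ite_mul, one_mul, zero_mul, Finset.sum_ite_eq, Finset.mem_univ,
    if_true, mul_ite, mul_one, mul_zero]
  have hi := i.2
  have hj := j.2
  by_cases c1 : (i : ℕ) = b <;> by_cases c2 : (j : ℕ) = 0
  · simp [rot_val, rotInv_val, c1, c2]
  · have : (j : ℕ) - 1 < a := by omega
    simp [rot_val, rotInv_val, c1, c2, this]
  · have : (i : ℕ) < b := by omega
    simp [rot_val, rotInv_val, c1, c2, this]
  · have : (i : ℕ) < b := by omega
    have : (j : ℕ) - 1 < a := by omega
    simp [rot_val, rotInv_val, *]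

/-- The prop `M_{⋆,⋆}(R)` of matrices with coefficients in `R`. -/
def matProp (R : Type u) [Semiring R] : PROP.{u} where
  toPropOps := matOps R
  comp_assoc f g h := Matrix.mul_assoc f g h
  tensor_assoc f g h := matOps_tensor_assoc f g h
  comp_tensor_comp f g h k := matOps_comp_tensor_comp f g h k
  tensor_one f := matOps_tensor_one f
  one_tensor f := matOps_one_tensor f
  comp_idPow f := by rw [matOps_idPow]; exact Matrix.mul_one f
  idPow_comp f := by rw [matOps_idPow]; exact Matrix.one_mul f
  sym_comp_sym := by
    rw [matOps_idPow]
    change !![0, 1; 1, 0] * !![0, 1; 1, 0] = (1 : Matrix (Fin 2) (Fin 2) R)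
    simp [Matrix.one_fin_two]
  sym_natural f := matOps_sym_natural f

end Matrices

/-! ### The presentation -/

/-- The generators `μ : 2 → 1`, `η : 0 → 1`, `Δ : 1 → 2`, `ε : 1 → 0` of the bialgebra prop,
together with `h : 1 → 1`. -/
inductive BialgGen : ℕ → ℕ → Type
  | mu : BialgGen 2 1
  | eta : BialgGen 0 1
  | delta : BialgGen 1 2
  | eps : BialgGen 1 0
  | h : BialgGen 1 1

namespace BialgGen

local infixr:80 " ∘ₑ " => Expr.comp
local infixr:90 " ⊗ₑ " => Expr.tensor
local notation "μ" => Expr.gen BialgGen.mu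
local notation "η" => Expr.gen BialgGen.eta
local notation "Δ" => Expr.gen BialgGen.delta
local notation "ε" => Expr.gen BialgGen.eps
local notation "𝐡" => Expr.gen BialgGen.h
local notation "𝟙" => Expr.id (G := BialgGen)
local notation "σ" => Expr.sym (G := BialgGen)

/-- The bialgebra equations, and the equations that say that `h` is a homomorphism of monoids and
of comonoids. -/
inductive Eqn : {a b : ℕ} → Expr BialgGen a b → Expr BialgGen a b → Prop
  | unit_left : Eqn (a := 1) (b := 1) (μ ∘ₑ (η ⊗ₑ 𝟙)) 𝟙
  | unit_right : Eqn (a := 1) (b := 1) (μ ∘ₑ (𝟙 ⊗ₑ η)) 𝟙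
  | assoc : Eqn (a := 3) (b := 1) (μ ∘ₑ (μ ⊗ₑ 𝟙)) (μ ∘ₑ (𝟙 ⊗ₑ μ))
  | comm : Eqn (a := 2) (b := 1) (μ ∘ₑ σ) μ
  | counit_left : Eqn (a := 1) (b := 1) ((ε ⊗ₑ 𝟙) ∘ₑ Δ) 𝟙
  | counit_right : Eqn (a := 1) (b := 1) ((𝟙 ⊗ₑ ε) ∘ₑ Δ) 𝟙
  | coassoc : Eqn (a := 1) (b := 3) ((Δ ⊗ₑ 𝟙) ∘ₑ Δ) ((𝟙 ⊗ₑ Δ) ∘ₑ Δ)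
  | cocomm : Eqn (a := 1) (b := 2) (σ ∘ₑ Δ) Δ
  | delta_eta : Eqn (a := 0) (b := 2) (Δ ∘ₑ η) (η ⊗ₑ η)
  | eps_mu : Eqn (a := 2) (b := 0) (ε ∘ₑ μ) (ε ⊗ₑ ε)
  | eps_eta : Eqn (a := 0) (b := 0) (ε ∘ₑ η) Expr.one
  | delta_mu : Eqn (a := 2) (b := 2)
      ((μ ⊗ₑ μ) ∘ₑ Expr.tensor (a := 3) (b := 3) (𝟙 ⊗ₑ σ) 𝟙 ∘ₑ (Δ ⊗ₑ Δ)) (Δ ∘ₑ μ)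
  | h_mu : Eqn (a := 2) (b := 1) (𝐡 ∘ₑ μ) (μ ∘ₑ (𝐡 ⊗ₑ 𝐡))
  | h_eta : Eqn (a := 0) (b := 1) (𝐡 ∘ₑ η) η
  | delta_h : Eqn (a := 1) (b := 2) ((𝐡 ⊗ₑ 𝐡) ∘ₑ Δ) (Δ ∘ₑ 𝐡)
  | eps_h : Eqn (a := 1) (b := 0) (ε ∘ₑ 𝐡) ε

end BialgGen

/-- The presentation of the bialgebra prop with an extra bialgebra endomorphism `h`. -/
def bialgHomPresentation : Presentation.{0} where
  Gen := BialgGen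
  Eqn := BialgGen.Eqn

/-- The matrices over `ℕ[X]` that correspond to the generators. -/
noncomputable def BialgGen.toMatrix :
    {a b : ℕ} → BialgGen a b → Matrix (Fin b) (Fin a) (Polynomial ℕ)
  | _, _, .mu => !![1, 1]
  | _, _, .eta => 0
  | _, _, .delta => !![1; 1]
  | _, _, .eps => 0
  | _, _, .h => !![Polynomial.X]

end PROP

/-! Bicommutative bimonoids in a symmetric monoidal category behave like modules. Morphisms are
added by convolution, f + g = Δ ≫ (f ⊗ g) ≫ μ, with zero ε ≫ η; bicommutativity is what makes the
sum a morphism of bimonoids again. For this addition the tensor product is a biproduct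
(`Bicomm.fst_inl_add_snd_inr`). Hence morphisms between tensor powers of one bimonoid U are matrices
over the semiring `End U`, and composition and tensor product become matrix product and direct sum
(`Powers.matMap_mul`, `Powers.matMap_tensor`).

To use this, a prop is turned into a symmetric monoidal category `Obj P`, whose whole symmetry is
recovered from σ and its naturality past one wire. A model of the presentation is then a
bicommutative bimonoid on the wire with an endomorphism h. Since ℕ[t] is the free semiring on one
generator, t ↦ h extends to a semiring homomorphism ℕ[t] → `End U`, and applying it to matrix
entries gives a prop functor (`matFunctor`). No normal form of circuits is needed.

Uniqueness holds because every matrix over ℕ[t] is built from the generators by products and direct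
sums (`MatClosed.all_polynomial`). The isomorphism with any other presented prop is the usual
comparison of two universal objects. -/

section

/-! ### A prop as a monoidal category. -/

open CategoryTheory MonoidalCategory

namespace PROP

/-- The objects of a prop, as a type that carries the category structure. -/
@[ext]
structure Obj (P : PROP.{u}) : Type where
  /-- The number of wires. -/
  n : ℕ

variable {P : PROP.{u}}

instance : Category.{u} (Obj P) where
  Hom a b := P.Hom a.n b.n
  id a := P.idPow a.n
  comp f g := P.comp g f
  id_comp f := P.comp_idPow f
  comp_id f := P.idPow_comp f
  assoc f g h := (P.comp_assoc h g f).symm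

/-- A morphism of a prop, as a morphism of the category. -/
def toHom {a b : ℕ} (f : P.Hom a b) : (⟨a⟩ : Obj P) ⟶ ⟨b⟩ := f

/-- A morphism of the category, as a morphism of the prop. -/
def ofHom {a b : ℕ} (f : (⟨a⟩ : Obj P) ⟶ ⟨b⟩) : P.Hom a b := f

/-- Addition recurses on its right argument, so a + b + 1 and a + (b + 1) agree definitionally and
the cast in `tensor_assoc` is trivial here. The same remark removes most coherence isomorphisms
later. -/
theorem idPow_add (a b : ℕ) : P.idPow (a + b) = P.tensor (P.idPow a) (P.idPow b) := by
  induction b with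
  | zero => exact (P.tensor_one _).symm
  | succ b ih =>
    change P.tensor (P.idPow (a + b)) P.id = _
    rw [ih]
    exact P.tensor_assoc (P.idPow a) (P.idPow b) P.id

/-- Turns the casts in the prop axioms into composites with `eqToHom`, so that these axioms become
naturality of the coherence isomorphisms. -/
theorem toHom_cast {a b a' b' : ℕ} (ha : a = a') (hb : b = b') (f : P.Hom a b) :
    toHom (P.cast ha hb f) =
      eqToHom (congrArg Obj.mk ha.symm) ≫ toHom f ≫ eqToHom (congrArg Obj.mk hb) := by
  subst ha hb
  simp only [eqToHom_refl, Category.comp_id, Category.id_comp]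
  rfl

instance : MonoidalCategoryStruct (Obj P) where
  tensorObj a b := ⟨a.n + b.n⟩
  whiskerLeft a _ _ f := P.tensor (P.idPow a.n) f
  whiskerRight f b := P.tensor f (P.idPow b.n)
  tensorHom f g := P.tensor f g
  tensorUnit := ⟨0⟩
  associator a b c := eqToIso (congrArg Obj.mk (Nat.add_assoc a.n b.n c.n))
  leftUnitor a := eqToIso (congrArg Obj.mk (Nat.zero_add a.n))
  rightUnitor a := Iso.refl a

theorem associator_def (a b c : Obj P) :
    α_ a b c = eqToIso (congrArg Obj.mk (Nat.add_assoc a.n b.n c.n)) := rfl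

theorem leftUnitor_def (a : Obj P) :
    λ_ a = eqToIso (congrArg Obj.mk (Nat.zero_add a.n)) := rfl

theorem rightUnitor_def (a : Obj P) : ρ_ a = Iso.refl a := rfl

theorem id_tensor_id (a b : Obj P) : 𝟙 a ⊗ₘ 𝟙 b = 𝟙 (a ⊗ b) := (idPow_add a.n b.n).symm

theorem id_tensor_eqToHom (c : Obj P) {a b : Obj P} (h : a = b) :
    𝟙 c ⊗ₘ eqToHom h = eqToHom (congrArg (c ⊗ ·) h) := by
  subst h
  exact id_tensor_id c a

theorem eqToHom_tensor_id (c : Obj P) {a b : Obj P} (h : a = b) :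
    eqToHom h ⊗ₘ 𝟙 c = eqToHom (congrArg (· ⊗ c) h) := by
  subst h
  exact id_tensor_id a c

instance : MonoidalCategory (Obj P) := MonoidalCategory.ofTensorHom
  (id_tensorHom_id := id_tensor_id)
  (id_tensorHom := fun _ _ _ _ => rfl)
  (tensorHom_id := fun _ _ => rfl)
  (tensorHom_comp_tensorHom := fun f g h k => (P.comp_tensor_comp h f k g).symm)
  (associator_naturality := fun {a b c a' b' c'} f g h => by
    have := (toHom_cast _ _ _).symm.trans (congrArg toHom (P.tensor_assoc f g h))
    rw [← cancel_epi (eqToHom (congrArg Obj.mk (Nat.add_assoc a.n b.n c.n).symm))]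
    simp only [associator_def, eqToIso.hom, eqToHom_trans_assoc, eqToHom_refl, Category.id_comp]
    exact this)
  (leftUnitor_naturality := fun {a b} f => by
    have := (toHom_cast _ _ _).symm.trans (congrArg toHom (P.one_tensor f))
    rw [← cancel_epi (eqToHom (congrArg Obj.mk (Nat.zero_add a.n).symm))]
    simp only [leftUnitor_def, eqToIso.hom, eqToHom_trans_assoc, eqToHom_refl, Category.id_comp]
    exact this)
  (rightUnitor_naturality := fun {a b} f => by
    refine (Category.comp_id _).trans ?_
    refine Eq.trans ?_ (Category.id_comp _).symm
    exact P.tensor_one f)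
  (pentagon := fun a b c d => by
    simp only [associator_def, eqToIso.hom]
    rw [id_tensor_eqToHom, eqToHom_tensor_id]
    simp)
  (triangle := fun a b => by
    simp only [associator_def, leftUnitor_def, rightUnitor_def, eqToIso.hom]
    rw [id_tensor_eqToHom, eqToHom_trans, Iso.refl_hom]
    exact (id_tensor_id a b).symm)

end PROP

end

/-! ### The symmetry that moves one wire past an object. -/

section

open CategoryTheory MonoidalCategory

namespace PROP

variable {P : PROP.{u}}

/-- The object `1` of a prop, a single wire. -/
def Obj.wire (P : PROP.{u}) : Obj P := ⟨1⟩

local notation "I" => Obj.wire _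

/-- Every object is a tensor power of a wire. -/
@[elab_as_elim]
theorem Obj.wire_induction {motive : Obj P → Prop} (unit : motive (𝟙_ (Obj P)))
    (tensor : ∀ a, motive a → motive (a ⊗ I)) (a : Obj P) : motive a := by
  obtain ⟨n⟩ := a
  induction n with
  | zero => exact unit
  | succ n ih => exact tensor ⟨n⟩ ih

theorem associator_wire (a b : Obj P) : α_ a b I = Iso.refl _ := rfl

/-- The symmetry of two wires. -/
def sigma : (I : Obj P) ⊗ I ⟶ I ⊗ I := toHom P.sym

theorem wire_tensor (a : Obj P) : I ⊗ a = a ⊗ I := congrArg Obj.mk (Nat.add_comm 1 a.n)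

/-- The iterated symmetry, as a morphism of the category. -/
def symHom (a : Obj P) : a ⊗ I ⟶ a ⊗ I := toHom (P.symPow a.n)

/-- The symmetry that moves a wire past an object. -/
def wireBraid (a : Obj P) : I ⊗ a ⟶ a ⊗ I := eqToHom (wire_tensor a) ≫ symHom a

theorem sigma_sigma : (sigma : (I : Obj P) ⊗ I ⟶ I ⊗ I) ≫ sigma = 𝟙 _ := P.sym_comp_sym

theorem idPow_one : P.idPow 1 = P.id := P.one_tensor P.id

theorem whiskerRight_wire {a b : Obj P} (f : a ⟶ b) : f ▷ I = toHom (P.tensor f P.id) := by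
  change P.tensor f (P.idPow 1) = _
  rw [idPow_one]; rfl

theorem wire_whiskerLeft {a b : Obj P} (f : a ⟶ b) : I ◁ f = toHom (P.tensor P.id f) := by
  change P.tensor (P.idPow 1) f = _
  rw [idPow_one]; rfl

theorem eqToHom_whiskerRight' (c : Obj P) {a b : Obj P} (h : a = b) :
    eqToHom h ▷ c = eqToHom (congrArg (· ⊗ c) h) := by
  subst h; simp

/-- The axiom `sym_natural`, its cast absorbed into `wireBraid`. It is the only naturality that the
prop provides for the symmetry; the others are derived from it. -/
theorem whiskerLeft_wireBraid {a b : Obj P} (f : a ⟶ b) :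
    I ◁ f ≫ wireBraid b = wireBraid a ≫ f ▷ I := by
  have h₁ : toHom (P.cast (Nat.add_comm 1 a.n) (Nat.add_comm 1 b.n) (P.tensor P.id f)) =
      eqToHom (wire_tensor a).symm ≫ I ◁ f ≫ eqToHom (wire_tensor b) := by
    rw [wire_whiskerLeft]; exact toHom_cast _ _ _
  have h₂ : symHom a ≫ f ▷ I =
      (eqToHom (wire_tensor a).symm ≫ I ◁ f ≫ eqToHom (wire_tensor b)) ≫ symHom b := by
    rw [whiskerRight_wire]
    exact (congrArg toHom (P.sym_natural f)).symm.trans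
      (congrArg (fun k : a ⊗ I ⟶ b ⊗ I => k ≫ symHom b) h₁)
  simp [wireBraid, h₂]

theorem wireBraid_unit : wireBraid (𝟙_ (Obj P)) = (ρ_ I).hom ≫ (λ_ I).inv := by
  refine (Category.id_comp (X := (⟨1⟩ : Obj P)) _).trans ?_
  refine Eq.trans ?_ (Category.id_comp (X := (⟨1⟩ : Obj P)) _).symm
  exact idPow_one.symm

/-- Applied to definitional equalities such as a = a ⊗ 𝟙, in order to make the invisible coherence
isomorphisms appear. -/
theorem wireBraid_of_eq {a b : Obj P} (h : a = b) :
    wireBraid b = I ◁ eqToHom h.symm ≫ wireBraid a ≫ eqToHom h ▷ I := by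
  subst h; simp

/-- The recursion that defines `symPow`, read as a hexagon identity. -/
theorem wireBraid_tensor_wire (a : Obj P) :
    wireBraid (a ⊗ I) = (α_ _ _ _).inv ≫ wireBraid a ▷ I ≫ (α_ _ _ _).hom ≫ a ◁ sigma ≫
      (α_ _ _ _).inv := by
  have h : symHom (a ⊗ I) = symHom a ▷ I ≫ a ◁ sigma := by
    rw [whiskerRight_wire]; rfl
  rw [associator_wire a, wireBraid, h, wireBraid, comp_whiskerRight, eqToHom_whiskerRight',
    associator_def]
  simp only [eqToIso.inv, Category.assoc, eqToHom_trans_assoc, Iso.refl_hom, Iso.refl_inv]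
  refine congrArg (_ ≫ ·) (congrArg (_ ≫ ·) ?_)
  refine Eq.trans ?_ (Category.id_comp _).symm
  exact (Category.comp_id _).symm

end PROP

end

/-! ### The full symmetry of a prop. -/

section

open CategoryTheory MonoidalCategory

namespace PROP

variable {P : PROP.{u}}

local notation "I" => Obj.wire _

theorem wireBraid_wire : wireBraid (I : Obj P) = sigma := by
  refine (Category.id_comp (X := (⟨2⟩ : Obj P)) _).trans ?_
  have h₁ : P.tensor (a := 0) (b := 0) (c := 2) (d := 2) P.one P.sym = P.sym :=
    P.one_tensor (a := 2) (b := 2) P.sym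
  have h₂ : P.tensor P.id P.id = P.idPow 2 := congrArg (fun k => P.tensor k P.id) idPow_one.symm
  exact (congrArg₂ (P.comp (a := 2) (b := 2) (c := 2)) h₁ h₂).trans (P.comp_idPow P.sym)

theorem wireBraid_tensor (a b : Obj P) :
    wireBraid (a ⊗ b) = (α_ _ _ _).inv ≫ wireBraid a ▷ b ≫ (α_ _ _ _).hom ≫ a ◁ wireBraid b ≫
      (α_ _ _ _).inv := by
  induction b using Obj.wire_induction with
  | unit =>
    have h : wireBraid (a ⊗ 𝟙_ _) = I ◁ (ρ_ a).hom ≫ wireBraid a ≫ (ρ_ a).inv ▷ I :=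
      wireBraid_of_eq (show a = a ⊗ 𝟙_ _ from rfl)
    simp [wireBraid_unit, h]
  | tensor b ih =>
    rw [wireBraid_tensor_wire, wireBraid_of_eq (show (a ⊗ b) ⊗ I = a ⊗ (b ⊗ I) from rfl)]
    rw [show eqToHom (show (a ⊗ b) ⊗ I = a ⊗ (b ⊗ I) from rfl) = (α_ a b I).hom from rfl,
      show eqToHom (show a ⊗ (b ⊗ I) = (a ⊗ b) ⊗ I from rfl) = (α_ a b I).inv from rfl]
    rw [wireBraid_tensor_wire, ih]
    simp [comp_whiskerRight]

/-- The symmetry of a prop. -/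
def symm : (m : ℕ) → (n : Obj P) → ((⟨m⟩ : Obj P) ⊗ n ⟶ n ⊗ ⟨m⟩)
  | 0, n => (λ_ n).hom ≫ (ρ_ n).inv
  | m + 1, n => ((α_ ⟨m⟩ I n).hom ≫ (⟨m⟩ : Obj P) ◁ wireBraid n ≫ (α_ _ _ _).inv ≫
      symm m n ▷ I ≫ (α_ _ _ _).hom : ((⟨m⟩ : Obj P) ⊗ I) ⊗ n ⟶ n ⊗ (⟨m⟩ ⊗ I))

/-- The symmetry of a prop. -/
def braid (a b : Obj P) : a ⊗ b ⟶ b ⊗ a := symm a.n b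

theorem braid_unit_left (b : Obj P) : braid (𝟙_ _) b = (λ_ b).hom ≫ (ρ_ b).inv := rfl

theorem braid_tensor_wire_left (a b : Obj P) :
    braid (a ⊗ I) b = (α_ _ _ _).hom ≫ a ◁ wireBraid b ≫ (α_ _ _ _).inv ≫
      braid a b ▷ I ≫ (α_ _ _ _).hom := rfl

theorem braid_of_eq_left {a a' : Obj P} (h : a = a') (b : Obj P) :
    braid a' b = eqToHom h.symm ▷ b ≫ braid a b ≫ b ◁ eqToHom h := by
  subst h; simp

theorem braid_naturality_right (a : Obj P) {b c : Obj P} (f : b ⟶ c) :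
    a ◁ f ≫ braid a c = braid a b ≫ f ▷ a := by
  induction a using Obj.wire_induction with
  | unit => simp [braid_unit_left]
  | tensor a ih =>
    rw [braid_tensor_wire_left, braid_tensor_wire_left]
    have := congrArg (a ◁ ·) (whiskerLeft_wireBraid f)
    simp only [MonoidalCategory.whiskerLeft_comp] at this
    simp [reassoc_of% this]
    rw [associator_inv_naturality_middle_assoc, ← comp_whiskerRight_assoc, ih]
    simp

theorem braid_tensor_left (a b c : Obj P) :
    braid (a ⊗ b) c = (α_ _ _ _).hom ≫ a ◁ braid b c ≫ (α_ _ _ _).inv ≫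
      braid a c ▷ b ≫ (α_ _ _ _).hom := by
  induction b using Obj.wire_induction with
  | unit =>
    have h : braid (a ⊗ 𝟙_ _) c = (ρ_ a).hom ▷ c ≫ braid a c ≫ c ◁ (ρ_ a).inv :=
      braid_of_eq_left (show a = a ⊗ 𝟙_ _ from rfl) c
    simp [braid_unit_left, h]
  | tensor b ih =>
    rw [braid_of_eq_left (show (a ⊗ b) ⊗ I = a ⊗ (b ⊗ I) from rfl)]
    rw [show eqToHom (show (a ⊗ b) ⊗ I = a ⊗ (b ⊗ I) from rfl) = (α_ a b I).hom from rfl,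
      show eqToHom (show a ⊗ (b ⊗ I) = (a ⊗ b) ⊗ I from rfl) = (α_ a b I).inv from rfl]
    rw [braid_tensor_wire_left, braid_tensor_wire_left, ih]
    simp

/-- The second hexagon does not come from the recursion in the left object: it is proved by
induction on a from the one-wire case `wireBraid_tensor`. -/
theorem braid_tensor_right (a b c : Obj P) :
    braid a (b ⊗ c) = (α_ _ _ _).inv ≫ braid a b ▷ c ≫ (α_ _ _ _).hom ≫ b ◁ braid a c ≫
      (α_ _ _ _).inv := by
  induction a using Obj.wire_induction with
  | unit => simp [braid_unit_left]
  | tensor a ih =>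
    rw [braid_tensor_wire_left, braid_tensor_wire_left, braid_tensor_wire_left, ih,
      wireBraid_tensor]
    calc
      _ = 𝟙 _ ⊗≫ a ◁ wireBraid b ▷ c ⊗≫ ((a ⊗ b) ◁ wireBraid c ≫ braid a b ▷ (c ⊗ I)) ⊗≫
          b ◁ braid a c ▷ I ⊗≫ 𝟙 _ := by monoidal
      -- The crossing of the last wire with c and that of a with b act on different factors, so they
      -- commute.
      _ = _ := by rw [whisker_exchange]; monoidal

/-- The two composites undo each other one crossing at a time, each pair cancelling by σ ∘ σ = id.
-/
theorem braid_wire_comp_wireBraid (a : Obj P) : braid a I ≫ wireBraid a = 𝟙 _ := by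
  induction a using Obj.wire_induction with
  | unit => simp [braid_unit_left, wireBraid_unit]
  | tensor a ih =>
    rw [braid_tensor_wire_left, wireBraid_tensor_wire, wireBraid_wire]
    have := congrArg (· ▷ I) ih
    simp only [comp_whiskerRight] at this
    have h2 := congrArg (a ◁ ·) (sigma_sigma (P := P))
    simp only [MonoidalCategory.whiskerLeft_comp] at h2
    simp [reassoc_of% this, reassoc_of% h2]

theorem wireBraid_comp_braid_wire (a : Obj P) : wireBraid a ≫ braid a I = 𝟙 _ := by
  induction a using Obj.wire_induction with
  | unit => simp [braid_unit_left, wireBraid_unit]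
  | tensor a ih =>
    rw [braid_tensor_wire_left, wireBraid_tensor_wire, wireBraid_wire]
    have := congrArg (· ▷ I) ih
    simp only [comp_whiskerRight] at this
    have h2 := congrArg (a ◁ ·) (sigma_sigma (P := P))
    simp only [MonoidalCategory.whiskerLeft_comp] at h2
    simp [reassoc_of% this, reassoc_of% h2]

theorem braid_unit_right (a : Obj P) : braid a (𝟙_ _) = (ρ_ a).hom ≫ (λ_ a).inv := by
  induction a using Obj.wire_induction with
  | unit => rw [braid_unit_left, unitors_equal, unitors_inv_equal]
  | tensor a ih =>
    rw [braid_tensor_wire_left, wireBraid_unit, ih]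
    simp

/-- Past one wire, this is `whiskerLeft_wireBraid` conjugated by the inverse crossings; the hexagon
`braid_tensor_right` extends it to all c. -/
theorem braid_naturality_left {a b : Obj P} (f : a ⟶ b) (c : Obj P) :
    f ▷ c ≫ braid b c = braid a c ≫ c ◁ f := by
  induction c using Obj.wire_induction with
  | unit => simp [braid_unit_right]
  | tensor c ih =>
    have hI : f ▷ I ≫ braid b I = braid a I ≫ I ◁ f := by
      have h := congrArg (fun k => braid a I ≫ k ≫ braid b I) (whiskerLeft_wireBraid f)
      simp only [Category.assoc, wireBraid_comp_braid_wire, Category.comp_id] at h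
      rw [h, reassoc_of% braid_wire_comp_wireBraid]
    have hI := congrArg (c ◁ ·) hI
    simp only [MonoidalCategory.whiskerLeft_comp] at hI
    rw [braid_tensor_right, braid_tensor_right]
    simp
    rw [← comp_whiskerRight_assoc, ih]
    simp [reassoc_of% hI]

theorem braid_braid (a b : Obj P) : braid a b ≫ braid b a = 𝟙 _ := by
  induction a using Obj.wire_induction with
  | unit => simp [braid_unit_left, braid_unit_right]
  | tensor a ih =>
    rw [braid_tensor_wire_left, braid_tensor_right]
    have h := congrArg (· ▷ I) ih
    simp only [comp_whiskerRight] at h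
    have h2 := congrArg (a ◁ ·) (wireBraid_comp_braid_wire b)
    simp only [MonoidalCategory.whiskerLeft_comp] at h2
    simp [reassoc_of% h, reassoc_of% h2]

instance : SymmetricCategory (Obj P) where
  braiding a b := ⟨braid a b, braid b a, braid_braid a b, braid_braid b a⟩
  braiding_naturality_right a _ _ f := braid_naturality_right a f
  braiding_naturality_left f c := braid_naturality_left f c
  hexagon_forward a b c := by simp [braid_tensor_right]
  hexagon_reverse a b c := by simp [braid_tensor_left]
  symmetry a b := braid_braid a b

end PROP

end

/-! ### Structure morphisms and tensor products of bicommutative bimonoids. -/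

section

open CategoryTheory MonoidalCategory MonObj ComonObj

namespace Bicommutative

variable {C : Type v} [Category.{u} C] [MonoidalCategory C] [SymmetricCategory C]

attribute [local instance] ComonObj.instTensorUnit

section Mon

variable {X Y Z W : C} [MonObj X] [MonObj Y] [MonObj Z] [MonObj W]

instance : IsMonHom (tensorμ X Y Z W) := by unfold tensorμ; infer_instance

/-- The Eckmann–Hilton phenomenon: commutativity makes the multiplication itself a monoid morphism.
Dually, cocommutativity makes Δ a comonoid morphism; both are needed to add morphisms of bimonoids.
-/
instance [IsCommMonObj X] : IsMonHom μ[X] where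
  one_hom := by simp [MonObj.tensorObj.one_def, ← unitors_equal]
  mul_hom := by simp [MonObj.tensorObj.mul_def]

instance : IsMonHom η[X] where
  one_hom := Category.id_comp _
  mul_hom := by
    change (λ_ _).hom ≫ _ = _
    simp [← unitors_equal]

end Mon

section Comon

variable {X Y Z W : C} [ComonObj X] [ComonObj Y] [ComonObj Z] [ComonObj W]

instance (f : X ⟶ Y) (g : Z ⟶ W) [IsComonHom f] [IsComonHom g] : IsComonHom (f ⊗ₘ g) where
  hom_counit := by simp
  hom_comul := by
    rw [Comon.tensorObj_comul, Comon.tensorObj_comul, Category.assoc, ← tensorμ_natural,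
      tensorHom_comp_tensorHom_assoc, tensorHom_comp_tensorHom_assoc, IsComonHom.hom_comul,
      IsComonHom.hom_comul]

instance : IsComonHom (α_ X Y Z).hom where
  hom_counit := by
    simp only [Comon.tensorObj_counit, MonoidalCategory.tensorHom_def]
    monoidal
  hom_comul := by
    simp only [Comon.tensorObj_comul]
    calc
      _ = (α_ X Y Z).hom ≫ (Δ ⊗ₘ Δ ⊗ₘ Δ) ≫
          (X ⊗ X) ◁ tensorμ Y Y Z Z ≫ tensorμ X X (Y ⊗ Z) (Y ⊗ Z) := by
        simp [MonoidalCategory.tensorHom_def]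
      _ = ((Δ ⊗ₘ Δ) ⊗ₘ Δ) ≫ tensorμ X X Y Y ▷ (Z ⊗ Z) ≫
          tensorμ (X ⊗ Y) (X ⊗ Y) Z Z ≫ ((α_ X Y Z).hom ⊗ₘ (α_ X Y Z).hom) := by
        rw [tensor_associativity, associator_naturality_assoc]
      _ = _ := by
        rw [← MonoidalCategory.tensorHom_id, tensorHom_comp_tensorHom_assoc, Category.comp_id,
          Category.assoc]

instance : IsComonHom (λ_ X).hom where
  hom_counit := by simp [MonoidalCategory.tensorHom_def]
  hom_comul := by
    rw [Comon.tensorObj_comul, ComonObj.instTensorUnit_comul, ← leftUnitor_naturality,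
      tensor_left_unitality]
    simp [MonoidalCategory.tensorHom_def]

instance : IsComonHom (ρ_ X).hom where
  hom_counit := by simp [MonoidalCategory.tensorHom_def, unitors_equal]
  hom_comul := by
    rw [Comon.tensorObj_comul, ComonObj.instTensorUnit_comul, ← rightUnitor_naturality,
      tensor_right_unitality]
    simp [MonoidalCategory.tensorHom_def]

-- Coassociativity rebrackets the fourfold comultiplication so that its two middle factors come from
-- a single Δ. The middle swap in the comultiplication of X ⊗ X is then absorbed by cocommutativity.
omit [SymmetricCategory C] in
theorem comul_comul_tensorHom :
    Δ[X] ≫ (Δ[X] ⊗ₘ Δ[X]) = Δ[X] ≫ X ◁ Δ[X] ≫ X ◁ Δ[X] ▷ X ≫ X ◁ (α_ _ _ _).hom ≫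
      (α_ _ _ _).inv := by
  have h := congrArg (X ◁ ·) (ComonObj.comul_assoc X)
  simp only [MonoidalCategory.whiskerLeft_comp] at h
  rw [MonoidalCategory.tensorHom_def, ComonObj.comul_assoc_flip_assoc]
  simp [reassoc_of% h]

instance [IsCommComonObj X] : IsComonHom Δ[X] where
  hom_counit := by simp [unitors_equal]
  hom_comul := by
    have h := congrArg (X ◁ · ▷ X) (IsCommComonObj.comul_comm X)
    simp only [MonoidalCategory.whiskerLeft_comp, comp_whiskerRight] at h
    rw [Comon.tensorObj_comul, ← Category.assoc, comul_comul_tensorHom]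
    simp [tensorμ, reassoc_of% h]

instance : IsComonHom ε[X] where
  hom_counit := Category.comp_id _
  hom_comul := by
    rw [ComonObj.instTensorUnit_comul]
    simp [← unitors_inv_equal]

end Comon

section Bimon

variable {X Y : C} [BimonObj X] [BimonObj Y]

instance : IsMonHom Δ[X] where
  one_hom := by simp
  mul_hom := by simp [MonObj.tensorObj.mul_def]

instance : IsMonHom ε[X] where
  one_hom := BimonObj.one_counit X
  mul_hom := by simp

instance : IsComonHom μ[X] where
  hom_counit := by simp
  hom_comul := by
    rw [Comon.tensorObj_comul, BimonObj.mul_comul, Category.assoc]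

instance : IsComonHom η[X] where
  hom_counit := BimonObj.one_counit X
  hom_comul := by simp [MonObj.tensorObj.one_def]

/-- The bimonoid axioms say that Δ and ε are monoid morphisms. For X ⊗ Y, Δ is (Δ ⊗ Δ) ≫ `tensorμ`,
a composite of monoid morphisms. -/
instance : IsMonHom Δ[X ⊗ Y] := by rw [Comon.tensorObj_comul]; infer_instance

instance : IsMonHom ε[X ⊗ Y] := by rw [Comon.tensorObj_counit]; infer_instance

instance : BimonObj (X ⊗ Y) where
  toMonObj := inferInstance
  toComonObj := inferInstance
  mul_comul := by exact IsMonHom.mul_hom Δ[X ⊗ Y]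
  one_comul := by exact IsMonHom.one_hom Δ[X ⊗ Y]
  mul_counit := by exact IsMonHom.mul_hom ε[X ⊗ Y]
  one_counit := by exact IsMonHom.one_hom ε[X ⊗ Y]

instance : BimonObj (𝟙_ C) where
  toMonObj := inferInstance
  toComonObj := ComonObj.instTensorUnit C
  mul_comul := by
    change (λ_ _).hom ≫ (λ_ _).inv = ((λ_ _).inv ⊗ₘ (λ_ _).inv) ≫ tensorμ _ _ _ _ ≫
      ((λ_ _).hom ⊗ₘ (λ_ _).hom)
    rw [MonoidalCategory.tensorHom_def', Category.assoc, ← tensor_left_unitality, leftUnitor_naturality]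
  one_comul := by
    change 𝟙 _ ≫ (λ_ _).inv = (λ_ _).inv ≫ (𝟙 _ ⊗ₘ 𝟙 _)
    simp
  mul_counit := by
    change (λ_ _).hom ≫ 𝟙 _ = (𝟙 _ ⊗ₘ 𝟙 _) ≫ (λ_ _).hom
    simp
  one_counit := Category.id_comp _

end Bimon

end Bicommutative

end

/-! ### Bicommutative bimonoids: addition of morphisms and biproducts. -/

section

open CategoryTheory MonoidalCategory MonObj ComonObj

attribute [local instance] ComonObj.instTensorUnit

/-! ### Convolution -/

namespace CategoryTheory.Conv

variable {C : Type v} [Category.{u} C] [MonoidalCategory C] {X Y Z : C}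

theorem mul_eq_tensorHom [ComonObj X] [MonObj Y] (f g : Conv X Y) :
    f * g = Δ[X] ≫ (MonoidalCategoryStruct.tensorHom (C := C) f g) ≫ μ[Y] := by
  exact congrArg (Δ[X] ≫ ·) ((Category.assoc _ _ _).symm.trans
    (congrArg (· ≫ μ[Y]) (MonoidalCategory.tensorHom_def (C := C) f g).symm))

end CategoryTheory.Conv

/-- A bicommutative bimonoid in a symmetric monoidal category. -/
structure Bicomm (C : Type v) [Category.{u} C] [MonoidalCategory C] [SymmetricCategory C] where
  /-- The underlying object. -/
  X : C
  [bimon : BimonObj X]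
  [comm : IsCommMonObj X]
  [cocomm : IsCommComonObj X]

namespace Bicomm

attribute [instance] bimon comm cocomm

variable {C : Type v} [Category.{u} C] [MonoidalCategory C] [SymmetricCategory C]

/-- A morphism of bicommutative bimonoids. -/
@[ext]
structure Hom (A B : Bicomm C) where
  /-- The underlying morphism. -/
  hom : A.X ⟶ B.X
  [isMonHom : IsMonHom hom]
  [isComonHom : IsComonHom hom]

attribute [instance] Hom.isMonHom Hom.isComonHom

instance : Category (Bicomm C) where
  Hom := Hom
  id A := ⟨𝟙 A.X⟩
  comp f g := ⟨f.hom ≫ g.hom⟩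

@[ext]
theorem hom_ext {A B : Bicomm C} {f g : A ⟶ B} (h : f.hom = g.hom) : f = g := Hom.ext h

@[simp] theorem id_hom (A : Bicomm C) : Hom.hom (𝟙 A) = 𝟙 A.X := rfl

@[simp] theorem comp_hom {A B D : Bicomm C} (f : A ⟶ B) (g : B ⟶ D) :
    (f ≫ g).hom = f.hom ≫ g.hom := rfl

instance (A B : Bicomm C) : Zero (A ⟶ B) := ⟨⟨ε[A.X] ≫ η[B.X]⟩⟩

/-- The omitted fields are found by instance search: all three factors are morphisms of both monoids
and comonoids, thanks to bicommutativity. -/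
instance (A B : Bicomm C) : Add (A ⟶ B) := ⟨fun f g => ⟨Δ[A.X] ≫ (f.hom ⊗ₘ g.hom) ≫ μ[B.X]⟩⟩

theorem zero_hom (A B : Bicomm C) : (0 : A ⟶ B).hom = ε[A.X] ≫ η[B.X] := rfl

theorem add_hom {A B : Bicomm C} (f g : A ⟶ B) :
    (f + g).hom = Δ[A.X] ≫ (f.hom ⊗ₘ g.hom) ≫ μ[B.X] := rfl

theorem add_hom_eq_mul {A B : Bicomm C} (f g : A ⟶ B) :
    (f + g).hom = (show Conv A.X B.X from f.hom) * (show Conv A.X B.X from g.hom) :=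
  (Conv.mul_eq_tensorHom _ _).symm

instance (A B : Bicomm C) : AddCommMonoid (A ⟶ B) where
  add_assoc f g h := by
    ext
    simp only [add_hom_eq_mul]
    exact _root_.mul_assoc (G := Conv A.X B.X) _ _ _
  zero_add f := by
    ext
    rw [add_hom_eq_mul]
    exact _root_.one_mul (M := Conv A.X B.X) _
  add_zero f := by
    ext
    rw [add_hom_eq_mul]
    exact _root_.mul_one (M := Conv A.X B.X) _
  add_comm f g := by
    -- A braiding inserted before μ slides through f ⊗ g, exchanging them, and is absorbed by Δ.
    ext
    rw [add_hom, add_hom, ← IsCommMonObj.mul_comm B.X, BraidedCategory.braiding_naturality_assoc,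
      IsCommComonObj.comul_comm_assoc, IsCommMonObj.mul_comm B.X]
  nsmul := nsmulRec

theorem add_comp {A B D : Bicomm C} (f g : A ⟶ B) (k : B ⟶ D) : (f + g) ≫ k = f ≫ k + g ≫ k := by
  ext
  simp [add_hom]

theorem comp_add {A B D : Bicomm C} (k : A ⟶ B) (f g : B ⟶ D) : k ≫ (f + g) = k ≫ f + k ≫ g := by
  ext
  simp [add_hom]

theorem zero_comp {A B D : Bicomm C} (k : B ⟶ D) : (0 : A ⟶ B) ≫ k = 0 := by
  ext
  simp [zero_hom]

theorem comp_zero {A B D : Bicomm C} (k : A ⟶ B) : k ≫ (0 : B ⟶ D) = 0 := by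
  ext
  simp [zero_hom]

theorem sum_comp {κ : Type*} (s : Finset κ) {A B D : Bicomm C} (f : κ → (A ⟶ B)) (k : B ⟶ D) :
    (∑ i ∈ s, f i) ≫ k = ∑ i ∈ s, f i ≫ k :=
  map_sum (⟨⟨(· ≫ k), zero_comp k⟩, fun f g => add_comp f g k⟩ : (A ⟶ B) →+ (A ⟶ D)) f s

theorem comp_sum {κ : Type*} (s : Finset κ) {A B D : Bicomm C} (k : A ⟶ B) (f : κ → (B ⟶ D)) :
    k ≫ (∑ i ∈ s, f i) = ∑ i ∈ s, k ≫ f i :=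
  map_sum (⟨⟨(k ≫ ·), comp_zero k⟩, fun f g => comp_add k f g⟩ : (B ⟶ D) →+ (A ⟶ D)) f s

/-- The product in `End` is composition in the order of functions, hence the exchange of left and
right laws. This order matches the matrix product. -/
instance (A : Bicomm C) : Semiring (End A) where
  __ := (inferInstance : Monoid (End A))
  __ := (inferInstance : AddCommMonoid (A ⟶ A))
  zero_mul f := comp_zero f
  mul_zero f := zero_comp f
  left_distrib f g h := add_comp g h f
  right_distrib f g h := comp_add h f g

/-! ### The tensor product is a biproduct -/

/-- The tensor product of bicommutative bimonoids. -/
abbrev tensor (A B : Bicomm C) : Bicomm C where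
  X := A.X ⊗ B.X

/-- The tensor product of morphisms of bicommutative bimonoids. -/
def tensorMap {A A' B B' : Bicomm C} (f : A ⟶ A') (g : B ⟶ B') : A.tensor B ⟶ A'.tensor B' :=
  Hom.mk (A := A.tensor B) (B := A'.tensor B') (f.hom ⊗ₘ g.hom)

variable (A B : Bicomm C)

def fst : A.tensor B ⟶ A := Hom.mk (A := A.tensor B) (B := A) ((𝟙 A.X ⊗ₘ ε[B.X]) ≫ (ρ_ _).hom)

def snd : A.tensor B ⟶ B := Hom.mk (A := A.tensor B) (B := B) ((ε[A.X] ⊗ₘ 𝟙 B.X) ≫ (λ_ _).hom)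

def inl : A ⟶ A.tensor B := Hom.mk (A := A) (B := A.tensor B) ((ρ_ _).inv ≫ (𝟙 A.X ⊗ₘ η[B.X]))

def inr : B ⟶ A.tensor B := Hom.mk (A := B) (B := A.tensor B) ((λ_ _).inv ≫ (η[A.X] ⊗ₘ 𝟙 B.X))

@[simp] theorem inl_fst : inl A B ≫ fst A B = 𝟙 A := by
  ext
  simp [inl, fst, ← MonoidalCategory.whiskerLeft_comp_assoc]

@[simp] theorem inr_snd : inr A B ≫ snd A B = 𝟙 B := by
  ext
  simp [inr, snd, ← MonoidalCategory.comp_whiskerRight_assoc]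

@[simp] theorem inl_snd : inl A B ≫ snd A B = 0 := by
  ext
  simp only [comp_hom, inl, snd, zero_hom, MonoidalCategory.id_tensorHom,
    MonoidalCategory.tensorHom_id, Category.assoc]
  rw [whisker_exchange_assoc, leftUnitor_naturality, ← rightUnitor_inv_naturality_assoc,
    unitors_equal, Iso.inv_hom_id_assoc]

@[simp] theorem inr_fst : inr A B ≫ fst A B = 0 := by
  ext
  simp only [comp_hom, inr, fst, zero_hom, MonoidalCategory.id_tensorHom,
    MonoidalCategory.tensorHom_id, Category.assoc]
  rw [← whisker_exchange_assoc, rightUnitor_naturality, ← leftUnitor_inv_naturality_assoc,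
    ← unitors_equal, Iso.inv_hom_id_assoc]

theorem tensorμ_tensorμ (X Y Z W : C) : tensorμ X Y Z W ≫ tensorμ X Z Y W = 𝟙 _ := by
  have h := congrArg (X ◁ · ▷ W) (SymmetricCategory.symmetry Y Z)
  simp only [MonoidalCategory.whiskerLeft_comp, comp_whiskerRight] at h
  simp [tensorμ, reassoc_of% h]

/-- The middle swaps in Δ and μ of A ⊗ B cancel, so the convolution is computed factor by factor: it
is 1 + 0 on A tensored with 0 + 1 on B. -/
theorem fst_inl_add_snd_inr : fst A B ≫ inl A B + snd A B ≫ inr A B = 𝟙 _ := by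
  have h₁ : (fst A B ≫ inl A B).hom = 𝟙 A.X ⊗ₘ (ε[B.X] ≫ η[B.X]) := by
    simp [fst, inl]
  have h₂ : (snd A B ≫ inr A B).hom = (ε[A.X] ≫ η[A.X]) ⊗ₘ 𝟙 B.X := by
    simp [snd, inr]
  have h₃ : Δ[A.X] ≫ (𝟙 A.X ⊗ₘ (ε[A.X] ≫ η[A.X])) ≫ μ[A.X] = 𝟙 A.X :=
    congrArg Hom.hom (add_zero (𝟙 A))
  have h₄ : Δ[B.X] ≫ ((ε[B.X] ≫ η[B.X]) ⊗ₘ 𝟙 B.X) ≫ μ[B.X] = 𝟙 B.X :=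
    congrArg Hom.hom (zero_add (𝟙 B))
  ext
  rw [add_hom, h₁, h₂, Comon.tensorObj_comul, MonObj.tensorObj.mul_def, Category.assoc,
    ← tensorμ_natural_assoc, reassoc_of% tensorμ_tensorμ, tensorHom_comp_tensorHom,
    tensorHom_comp_tensorHom, h₃, h₄]
  simp

variable {A B}

theorem inl_tensorMap {A' B' : Bicomm C} (f : A ⟶ A') (g : B ⟶ B') :
    inl A B ≫ tensorMap f g = f ≫ inl A' B' := by
  ext
  have : η[B.X] ≫ g.hom = η[B'.X] := IsMonHom.one_hom g.hom
  simp only [comp_hom, inl, tensorMap, Category.assoc, tensorHom_comp_tensorHom, this,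
    Category.id_comp]
  rw [rightUnitor_inv_naturality_assoc, ← MonoidalCategory.tensorHom_id,
    tensorHom_comp_tensorHom, Category.id_comp, Category.comp_id]

theorem inr_tensorMap {A' B' : Bicomm C} (f : A ⟶ A') (g : B ⟶ B') :
    inr A B ≫ tensorMap f g = g ≫ inr A' B' := by
  ext
  have : η[A.X] ≫ f.hom = η[A'.X] := IsMonHom.one_hom f.hom
  simp only [comp_hom, inr, tensorMap, Category.assoc, tensorHom_comp_tensorHom, this,
    Category.id_comp]
  rw [leftUnitor_inv_naturality_assoc, ← MonoidalCategory.id_tensorHom,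
    tensorHom_comp_tensorHom, Category.id_comp, Category.comp_id]

variable (A B) (D : Bicomm C)

/-- The associator of bicommutative bimonoids. -/
def assoc : (A.tensor B).tensor D ⟶ A.tensor (B.tensor D) :=
  Hom.mk (A := (A.tensor B).tensor D) (B := A.tensor (B.tensor D)) (α_ A.X B.X D.X).hom

/-- This and the two lemmas that follow determine the associator on each of the three summands,
which is how regroupings of wires are compared with block matrices. -/
theorem inl_inl_assoc :
    inl A B ≫ inl (A.tensor B) D ≫ assoc A B D = inl A (B.tensor D) := by
  ext
  simp only [comp_hom, inl, assoc, MonObj.tensorObj.one_def,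
    MonoidalCategory.tensorHom_def]
  monoidal

theorem inr_inl_assoc :
    inr A B ≫ inl (A.tensor B) D ≫ assoc A B D = inl B D ≫ inr A (B.tensor D) := by
  ext
  simp only [comp_hom, inl, inr, assoc, MonoidalCategory.id_tensorHom,
    MonoidalCategory.tensorHom_id]
  calc
    _ = 𝟙 _ ⊗≫ (η[A.X] ▷ (B.X ⊗ 𝟙_ C) ≫ A.X ◁ B.X ◁ η[D.X]) ⊗≫ 𝟙 _ := by monoidal
    _ = _ := by
      rw [← whisker_exchange]
      monoidal

theorem inr_assoc :
    inr (A.tensor B) D ≫ assoc A B D = inr B D ≫ inr A (B.tensor D) := by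
  ext
  simp only [comp_hom, inr, assoc, MonObj.tensorObj.one_def,
    MonoidalCategory.tensorHom_def']
  monoidal

end Bicomm

end

/-! ### Matrix calculus on the powers of a bimonoid. -/

section

open CategoryTheory MonoidalCategory MonObj ComonObj

namespace Bicomm

variable {C : Type v} [Category.{u} C] [MonoidalCategory C] [SymmetricCategory C]

/-- A sequence of objects in which the `n`-th one is a biproduct of `n` copies of `U`. -/
structure Powers (U : Bicomm C) where
  /-- The biproduct of `n` copies of `U`. -/
  pow : ℕ → Bicomm C
  /-- The projections. -/
  proj : {n : ℕ} → Fin n → (pow n ⟶ U)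
  /-- The inclusions. -/
  incl : {n : ℕ} → Fin n → (U ⟶ pow n)
  incl_proj : ∀ {n : ℕ} (i j : Fin n), incl i ≫ proj j = if i = j then 𝟙 U else 0
  sum_proj_incl : ∀ n : ℕ, ∑ i : Fin n, proj i ≫ incl i = 𝟙 (pow n)

namespace Powers

variable {U : Bicomm C} (S : Powers U)

/-- Inserting the decomposition of the identity on both sides writes a morphism as the sum of its
matrix entries. -/
theorem hom_ext {n m : ℕ} {f g : S.pow n ⟶ S.pow m}
    (h : ∀ i j, S.incl j ≫ f ≫ S.proj i = S.incl j ≫ g ≫ S.proj i) : f = g := by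
  have key (f : S.pow n ⟶ S.pow m) : f =
      ∑ j, ∑ i, S.proj j ≫ (S.incl j ≫ f ≫ S.proj i) ≫ S.incl i := by
    have h : f = 𝟙 _ ≫ f ≫ 𝟙 _ := by simp
    rw [← S.sum_proj_incl, ← S.sum_proj_incl] at h
    refine h.trans ?_
    simp only [sum_comp, comp_sum, Category.assoc]
    first | rfl | exact Finset.sum_comm
  rw [key f, key g]
  simp only [h]

variable {R : Type*} [Semiring R] (φ : R →+* End U)

/-- The morphism with a given matrix of components. -/
def matMap {n m : ℕ} (A : Matrix (Fin m) (Fin n) R) : S.pow n ⟶ S.pow m :=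
  ∑ i, ∑ j, S.proj j ≫ φ (A i j) ≫ S.incl i

theorem incl_matMap_proj {n m : ℕ} (A : Matrix (Fin m) (Fin n) R) (i : Fin m) (j : Fin n) :
    S.incl j ≫ S.matMap φ A ≫ S.proj i = φ (A i j) := by
  simp only [matMap, sum_comp, comp_sum, Category.assoc, incl_proj]
  rw [Finset.sum_eq_single i, Finset.sum_eq_single j]
  · rw [← Category.assoc, incl_proj]
    simp
  · intro k _ hk
    rw [← Category.assoc, incl_proj, if_neg hk.symm, zero_comp]
  · simp
  · intro k _ hk
    simp [if_neg hk, comp_zero]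
  · simp

theorem matMap_mul {n m k : ℕ} (A : Matrix (Fin k) (Fin m) R) (B : Matrix (Fin m) (Fin n) R) :
    S.matMap φ (A * B) = S.matMap φ B ≫ S.matMap φ A := by
  refine S.hom_ext fun i j => ?_
  rw [incl_matMap_proj, Matrix.mul_apply, map_sum]
  have h : S.matMap φ B ≫ S.matMap φ A = S.matMap φ B ≫ 𝟙 _ ≫ S.matMap φ A := by simp
  rw [h, ← S.sum_proj_incl]
  simp only [sum_comp, comp_sum, Category.assoc, incl_matMap_proj]
  refine Finset.sum_congr rfl fun l _ => ?_
  rw [map_mul, End.mul_def, ← incl_matMap_proj S φ B l j]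
  simp

theorem hom_ext_left {n : ℕ} {Z : Bicomm C} {f g : S.pow n ⟶ Z}
    (h : ∀ j, S.incl j ≫ f = S.incl j ≫ g) : f = g := by
  rw [← Category.id_comp f, ← Category.id_comp g, ← S.sum_proj_incl]
  simp only [sum_comp, Category.assoc, h]

theorem incl_matMap {n m : ℕ} (A : Matrix (Fin m) (Fin n) R) (j : Fin n) :
    S.incl j ≫ S.matMap φ A = ∑ i, φ (A i j) ≫ S.incl i := by
  have h : S.incl j ≫ S.matMap φ A = S.incl j ≫ S.matMap φ A ≫ 𝟙 _ := by simp
  rw [h, ← S.sum_proj_incl]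
  simp only [comp_sum, ← incl_matMap_proj S φ A, Category.assoc]

/-- The maps e and e' compare the chosen power with a tensor product and are known only through the
inclusions. That suffices, since both sides can be compared column by column. -/
theorem matMap_tensor {a b c d : ℕ} (e : S.pow (a + c) ⟶ (S.pow a).tensor (S.pow c))
    (e' : S.pow (b + d) ⟶ (S.pow b).tensor (S.pow d))
    (he₁ : ∀ i, S.incl (Fin.castAdd c i) ≫ e = S.incl i ≫ inl _ _)
    (he₂ : ∀ i, S.incl (Fin.natAdd a i) ≫ e = S.incl i ≫ inr _ _)
    (he'₁ : ∀ i, S.incl (Fin.castAdd d i) ≫ e' = S.incl i ≫ inl _ _)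
    (he'₂ : ∀ i, S.incl (Fin.natAdd b i) ≫ e' = S.incl i ≫ inr _ _)
    (A : Matrix (Fin b) (Fin a) R) (B : Matrix (Fin d) (Fin c) R)
    (M : Matrix (Fin (b + d)) (Fin (a + c)) R) (hM : M = (PROP.matOps R).tensor A B) :
    S.matMap φ M ≫ e' =
      e ≫ tensorMap (S.matMap φ A) (S.matMap φ B) := by
  have hM (i j) := (congrFun (congrFun hM i) j).trans (PROP.matOps_tensor_apply A B i j)
  refine S.hom_ext_left fun j => ?_
  rw [reassoc_of% S.incl_matMap φ]
  simp only [hM, Fin.sum_univ_add, add_comp, sum_comp, Category.assoc,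
    he'₁, he'₂]
  induction j using Fin.addCases with
  | left j =>
    rw [reassoc_of% he₁, inl_tensorMap, reassoc_of% S.incl_matMap φ]
    simp [zero_comp, sum_comp]
  | right j =>
    rw [reassoc_of% he₂, inr_tensorMap, reassoc_of% S.incl_matMap φ]
    simp [zero_comp, sum_comp]

end Powers

end Bicomm

end

/-! ### The objects of a prop as powers of the wire. -/

section

open CategoryTheory MonoidalCategory MonObj ComonObj

namespace PROP

attribute [local instance] ComonObj.instTensorUnit

/-- The structure of a bicommutative bimonoid on an object. -/
structure BicommStr {P : PROP.{u}} (X : Obj P) where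
  bimon : BimonObj X
  comm : IsCommMonObj X
  cocomm : IsCommComonObj X

variable {P : PROP.{u}}

/-- The bicommutative bimonoid with a given structure. -/
abbrev BicommStr.toBicomm {X : Obj P} (s : BicommStr X) : Bicomm (Obj P) :=
  { X := X, bimon := s.bimon, comm := s.comm, cocomm := s.cocomm }

variable (s : BicommStr (Obj.wire P))

/-- A bicommutative bimonoid structure on the wire induces one on every object. -/
def powStr : (n : ℕ) → BicommStr (⟨n⟩ : Obj P)
  | 0 => (⟨inferInstance, inferInstance, inferInstance⟩ : BicommStr (𝟙_ (Obj P)))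
  | n + 1 =>
    let A := (powStr n).toBicomm.tensor s.toBicomm
    (⟨A.bimon, A.comm, A.cocomm⟩ : BicommStr A.X)

/-- The objects of a prop, as bicommutative bimonoids. -/
def powB (n : ℕ) : Bicomm (Obj P) := (powStr s n).toBicomm

/-- The bimonoid on `n + 1` is the tensor product of those on `n` and `1`. -/
def succIso (n : ℕ) : powB s (n + 1) ≅ (powB s n).tensor s.toBicomm := Iso.refl _

/-- The inclusion of the first `n` wires. -/
def initB (n : ℕ) : powB s n ⟶ powB s (n + 1) := Bicomm.inl _ _ ≫ (succIso s n).inv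

/-- The inclusion of the last wire. -/
def lastB (n : ℕ) : s.toBicomm ⟶ powB s (n + 1) := Bicomm.inr _ _ ≫ (succIso s n).inv

/-- The projection to the first `n` wires. -/
def toInitB (n : ℕ) : powB s (n + 1) ⟶ powB s n := (succIso s n).hom ≫ Bicomm.fst _ _

/-- The projection to the last wire. -/
def toLastB (n : ℕ) : powB s (n + 1) ⟶ s.toBicomm := (succIso s n).hom ≫ Bicomm.snd _ _

/-- The projection to a wire. -/
def projB : {n : ℕ} → Fin n → (powB s n ⟶ s.toBicomm)
  | n + 1, i => Fin.lastCases (toLastB s n) (fun i => toInitB s n ≫ projB i) i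

/-- The inclusion of a wire. -/
def inclB : {n : ℕ} → Fin n → (s.toBicomm ⟶ powB s n)
  | n + 1, i => Fin.lastCases (lastB s n) (fun i => inclB i ≫ initB s n) i

theorem projB_last (n : ℕ) : projB s (Fin.last n) = toLastB s n := by simp [projB]

theorem projB_castSucc {n : ℕ} (i : Fin n) : projB s i.castSucc = toInitB s n ≫ projB s i := by
  simp [projB]

theorem inclB_last (n : ℕ) : inclB s (Fin.last n) = lastB s n := by simp [inclB]

theorem inclB_castSucc {n : ℕ} (i : Fin n) : inclB s i.castSucc = inclB s i ≫ initB s n := by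
  simp [inclB]

/-- The objects of a prop are the powers of the wire. -/
def powers : Bicomm.Powers s.toBicomm where
  pow := powB s
  proj := projB s
  incl := inclB s
  incl_proj {n} i j := by
    induction n with
    | zero => exact i.elim0
    | succ n ih =>
      have h₁ : initB s n ≫ toInitB s n = 𝟙 _ := by
        simp [initB, toInitB]
      have h₂ : initB s n ≫ toLastB s n = 0 := by
        simp [initB, toLastB]
      have h₃ : lastB s n ≫ toInitB s n = 0 := by
        simp [lastB, toInitB]
      have h₄ : lastB s n ≫ toLastB s n = 𝟙 _ := by
        simp [lastB, toLastB]
      induction i using Fin.lastCases <;> induction j using Fin.lastCases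
      · simp [inclB_last, projB_last, h₄]
      · simp [inclB_last, projB_castSucc, reassoc_of% h₃, Bicomm.zero_comp,
          (Fin.castSucc_lt_last _).ne']
      · simp [inclB_castSucc, projB_last, h₂, Bicomm.comp_zero]
      · simp [inclB_castSucc, projB_castSucc, reassoc_of% h₁, ih]
  sum_proj_incl n := by
    induction n with
    | zero =>
      -- The empty sum is ε ≫ η, which on the unit object is the identity.
      rw [Finset.univ_eq_empty, Finset.sum_empty]
      ext
      exact Category.id_comp (𝟙 (𝟙_ (Obj P)))
    | succ n ih =>
      have h : ∑ i : Fin n, toInitB s n ≫ projB s i ≫ inclB s i ≫ initB s n =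
          toInitB s n ≫ initB s n := by
        have := congrArg (fun k => toInitB s n ≫ k ≫ initB s n) ih
        simpa [Bicomm.comp_sum, Bicomm.sum_comp] using this
      rw [Fin.sum_univ_castSucc]
      simp only [projB_castSucc, inclB_castSucc, projB_last, inclB_last, Category.assoc]
      rw [h, ← cancel_mono (succIso s n).hom, ← cancel_epi (succIso s n).inv]
      simp only [Bicomm.add_comp, Bicomm.comp_add]
      simp [initB, lastB, toInitB, toLastB, Bicomm.fst_inl_add_snd_inr]

/-- The identification of `a + c` with `a ⊗ c`, as a morphism of bimonoids. -/
def split (a : ℕ) : (c : ℕ) → (powB s (a + c) ⟶ (powB s a).tensor (powB s c))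
  | 0 => Bicomm.inl (powB s a) (powB s 0)
  | c + 1 => (succIso s (a + c)).hom ≫ Bicomm.tensorMap (split a c) (𝟙 s.toBicomm) ≫
      Bicomm.assoc (powB s a) (powB s c) s.toBicomm ≫ Bicomm.tensorMap (𝟙 _) (succIso s c).inv

/-- The right unitor, and the associator whose last factor is a wire, are identities of the prop. So
`split` only relates two bimonoid structures on one object, and disappears after passing to
underlying morphisms. -/
theorem split_hom (a c : ℕ) : (split s a c).hom = 𝟙 ((⟨a⟩ : Obj P) ⊗ ⟨c⟩) := by
  induction c with
  | zero =>
    have h : (ρ_ (⟨a⟩ : Obj P)).inv ≫ (𝟙 (⟨a⟩ : Obj P) ⊗ₘ 𝟙 (𝟙_ (Obj P))) =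
        (ρ_ (⟨a⟩ : Obj P)).inv := by simp
    exact h
  | succ c ih =>
    have h : 𝟙 _ ≫ (𝟙 ((⟨a⟩ : Obj P) ⊗ ⟨c⟩) ⊗ₘ 𝟙 (Obj.wire P)) ≫
        (α_ (⟨a⟩ : Obj P) ⟨c⟩ (Obj.wire P)).hom ≫ (𝟙 (⟨a⟩ : Obj P) ⊗ₘ 𝟙 (⟨c⟩ ⊗ (Obj.wire P))) =
        (α_ (⟨a⟩ : Obj P) ⟨c⟩ (Obj.wire P)).hom := by simp
    rw [← ih] at h
    exact h

theorem initB_split (a c : ℕ) :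
    initB s (a + c) ≫ split s a (c + 1) = split s a c ≫ Bicomm.inl _ _ ≫ Bicomm.assoc _ _ _ ≫
      Bicomm.tensorMap (𝟙 _) (succIso s c).inv := by
  rw [initB, split, Category.assoc, Iso.inv_hom_id_assoc,
    reassoc_of% Bicomm.inl_tensorMap (split s a c) (𝟙 s.toBicomm)]

theorem inclB_split_left (a c : ℕ) (i : Fin a) :
    inclB s (Fin.castAdd c i) ≫ split s a c = inclB s i ≫ Bicomm.inl _ _ := by
  induction c with
  | zero => rfl
  | succ c ih =>
    have h : inclB s (Fin.castAdd (c + 1) i) = inclB s (Fin.castAdd c i) ≫ initB s (a + c) :=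
      inclB_castSucc s (Fin.castAdd c i)
    rw [h, Category.assoc, initB_split, reassoc_of% ih, reassoc_of% Bicomm.inl_inl_assoc,
      Bicomm.inl_tensorMap, Category.id_comp]

theorem inclB_split_right (a c : ℕ) (i : Fin c) :
    inclB s (Fin.natAdd a i) ≫ split s a c = inclB s i ≫ Bicomm.inr _ _ := by
  induction c with
  | zero => exact i.elim0
  | succ c ih =>
    induction i using Fin.lastCases with
    | last =>
      have h : inclB s (Fin.natAdd a (Fin.last c)) = lastB s (a + c) := inclB_last s (a + c)
      rw [h, inclB_last, lastB, split, Category.assoc, Iso.inv_hom_id_assoc,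
        reassoc_of% Bicomm.inr_tensorMap (split s a c) (𝟙 s.toBicomm),
        reassoc_of% Bicomm.inr_assoc, Bicomm.inr_tensorMap, lastB, Category.assoc]
    | cast i =>
      have h : inclB s (Fin.natAdd a i.castSucc) = inclB s (Fin.natAdd a i) ≫ initB s (a + c) :=
        inclB_castSucc s (Fin.natAdd a i)
      rw [h, Category.assoc, initB_split, reassoc_of% ih, reassoc_of% Bicomm.inr_inl_assoc,
        Bicomm.inr_tensorMap, inclB_castSucc, initB, Category.assoc, Category.assoc]

end PROP

end

/-! ### The prop functor defined by a bimonoid and a semiring action. -/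

section

open CategoryTheory MonoidalCategory MonObj ComonObj

namespace Bicomm

variable {C : Type v} [Category.{u} C] [MonoidalCategory C] [SymmetricCategory C]

/-- The braiding exchanges the inclusions and is a monoid morphism, so composing it with
`fst_inl_add_snd_inr` gives this sum. It identifies the swap matrix with the symmetry. -/
theorem fst_inr_add_snd_inl_hom (A B : Bicomm C) :
    (fst A B ≫ inr B A + snd A B ≫ inl B A).hom = (β_ A.X B.X).hom := by
  have h₁ : (inl A B).hom ≫ (β_ A.X B.X).hom = (inr B A).hom := by
    simp [inl, inr]
  have h₂ : (inr A B).hom ≫ (β_ A.X B.X).hom = (inl B A).hom := by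
    simp [inl, inr]
  have h := congrArg (fun k => Hom.hom k ≫ (β_ A.X B.X).hom) (fst_inl_add_snd_inr A B)
  rw [add_hom] at h
  have h₃ : μ[A.X ⊗ B.X] ≫ (β_ A.X B.X).hom =
    ((β_ A.X B.X).hom ⊗ₘ (β_ A.X B.X).hom) ≫ μ[B.X ⊗ A.X] := IsMonHom.mul_hom _
  simp only [Category.assoc, h₃, tensorHom_comp_tensorHom_assoc, comp_hom, h₁, h₂, id_hom,
    Category.id_comp] at h
  rw [← h, add_hom]
  rfl

/-- The multiplication, as a morphism of bimonoids. -/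
def mulB (A : Bicomm C) : A.tensor A ⟶ A := Hom.mk (A := A.tensor A) (B := A) μ[A.X]

/-- The comultiplication, as a morphism of bimonoids. -/
def comulB (A : Bicomm C) : A ⟶ A.tensor A := Hom.mk (A := A) (B := A.tensor A) Δ[A.X]

attribute [local instance] ComonObj.instTensorUnit

/-- The unit object, as a bimonoid. -/
abbrev unit (C : Type v) [Category.{u} C] [MonoidalCategory C] [SymmetricCategory C] : Bicomm C :=
  ⟨𝟙_ C⟩

/-- The unit, as a morphism of bimonoids. -/
def oneB (A : Bicomm C) : unit C ⟶ A := Hom.mk (A := unit C) (B := A) η[A.X]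

/-- The counit, as a morphism of bimonoids. -/
def counitB (A : Bicomm C) : A ⟶ unit C := Hom.mk (A := A) (B := unit C) ε[A.X]

theorem inl_mulB (A : Bicomm C) : inl A A ≫ mulB A = 𝟙 A := by
  ext
  simp [inl, mulB]

theorem inr_mulB (A : Bicomm C) : inr A A ≫ mulB A = 𝟙 A := by
  ext
  simp [inr, mulB]

/-- By the counit laws both projections of Δ are identities, so Δ is the column with entries 1, 1.
-/
theorem comulB_eq (A : Bicomm C) : comulB A = inl A A + inr A A := by
  have h₁ : comulB A ≫ fst A A = 𝟙 A := by
    ext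
    simp [fst, comulB]
  have h₂ : comulB A ≫ snd A A = 𝟙 A := by
    ext
    simp [snd, comulB]
  rw [← Category.comp_id (comulB A), ← fst_inl_add_snd_inr, comp_add, reassoc_of% h₁,
    reassoc_of% h₂]

end Bicomm

namespace PROP

variable {P : PROP.{u}} (s : BicommStr (Obj.wire P))

/-- The bimonoid on `1` is the given one. -/
def oneB : powB s 1 ⟶ s.toBicomm := projB s 0

/-- As a bimonoid, `powB s 1` is 𝟙 ⊗ I rather than I; the comparison is a left unitor, an identity
because 0 + 1 reduces to 1. -/
theorem oneB_hom : (oneB s).hom = 𝟙 (Obj.wire P) := by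
  have h : 𝟙 _ ≫ (𝟙 (𝟙_ (Obj P)) ⊗ₘ 𝟙 (Obj.wire P)) ≫ (λ_ (Obj.wire P)).hom =
      (λ_ (Obj.wire P)).hom := by simp
  exact h

theorem inclB_oneB : inclB s 0 ≫ oneB s = 𝟙 _ := (powers s).incl_proj 0 0

/-- The bimonoid on `0` is the trivial one. -/
def zeroIso : powB s 0 ≅ Bicomm.unit (Obj P) := Iso.refl _

/-- The bimonoid on `2` is the tensor square of the given one. -/
def twoB : powB s 2 ⟶ s.toBicomm.tensor s.toBicomm :=
  split s 1 1 ≫ Bicomm.tensorMap (oneB s) (oneB s)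

theorem twoB_hom : (twoB s).hom = 𝟙 (Obj.wire P ⊗ Obj.wire P) := by
  have h : (split s 1 1).hom ≫ ((oneB s).hom ⊗ₘ (oneB s).hom) =
      𝟙 (Obj.wire P ⊗ Obj.wire P) := by
    rw [split_hom, oneB_hom]
    exact (Category.id_comp _).trans (id_tensor_id _ _)
  exact h

theorem inclB_zero_twoB : inclB s 0 ≫ twoB s = Bicomm.inl _ _ := by
  have h : inclB s (0 : Fin 2) ≫ split s 1 1 = inclB s 0 ≫ Bicomm.inl _ _ :=
    inclB_split_left s 1 1 0
  rw [twoB, reassoc_of% h, Bicomm.inl_tensorMap, reassoc_of% inclB_oneB]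

theorem inclB_one_twoB : inclB s 1 ≫ twoB s = Bicomm.inr _ _ := by
  have h : inclB s (1 : Fin 2) ≫ split s 1 1 = inclB s 0 ≫ Bicomm.inr _ _ :=
    inclB_split_right s 1 1 0
  rw [twoB, reassoc_of% h, Bicomm.inr_tensorMap, reassoc_of% inclB_oneB]

/-- The braiding is inverse to `wireBraid I` = σ, and σ is an involution. -/
theorem braiding_wire : (β_ (Obj.wire P) (Obj.wire P)).hom = sigma := by
  have h := braid_wire_comp_wireBraid (Obj.wire P)
  rw [wireBraid_wire] at h
  have h' := congrArg (· ≫ sigma) h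
  simp only [Category.assoc, sigma_sigma, Category.comp_id, Category.id_comp] at h'
  exact h'

section

variable {R : Type*} [Semiring R] (φ : R →+* End s.toBicomm)

/-- The action of a matrix on the powers of the wire. -/
abbrev matB {n m : ℕ} (A : Matrix (Fin m) (Fin n) R) : powB s n ⟶ powB s m :=
  (powers s).matMap φ A

theorem inclB_matB {n m : ℕ} (A : Matrix (Fin m) (Fin n) R) (j : Fin n) :
    inclB s j ≫ matB s φ A = ∑ i, φ (A i j) ≫ inclB s i := (powers s).incl_matMap φ A j

theorem powB_ext {n : ℕ} {Z : Bicomm (Obj P)} {f g : powB s n ⟶ Z}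
    (h : ∀ j, inclB s j ≫ f = inclB s j ≫ g) : f = g := (powers s).hom_ext_left h

theorem matB_one (n : ℕ) : matB s φ (1 : Matrix (Fin n) (Fin n) R) = 𝟙 _ := by
  refine powB_ext s fun j => ?_
  rw [inclB_matB, Finset.sum_eq_single j]
  · simp [End.one_def]
  · intro i _ hi
    simp [Matrix.one_apply_ne hi, Bicomm.zero_comp]
  · simp

theorem matB_scalar (r : R) : matB s φ !![r] ≫ oneB s = oneB s ≫ φ r := by
  refine powB_ext s fun j => ?_
  obtain rfl := Subsingleton.elim 0 j
  rw [reassoc_of% inclB_matB, reassoc_of% inclB_oneB]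
  simp [inclB_oneB]

theorem matB_mul : matB s φ !![1, 1] ≫ oneB s = twoB s ≫ Bicomm.mulB _ := by
  refine powB_ext s fun j => ?_
  rw [reassoc_of% inclB_matB]
  fin_cases j
  · simp [inclB_oneB, reassoc_of% inclB_zero_twoB, Bicomm.inl_mulB, End.one_def]
  · simp [inclB_oneB, reassoc_of% inclB_one_twoB, Bicomm.inr_mulB, End.one_def]

theorem matB_comul : matB s φ !![1; 1] ≫ twoB s = oneB s ≫ Bicomm.comulB _ := by
  refine powB_ext s fun j => ?_
  obtain rfl := Subsingleton.elim 0 j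
  rw [reassoc_of% inclB_matB, reassoc_of% inclB_oneB]
  simp [inclB_zero_twoB, inclB_one_twoB, Bicomm.comulB_eq, End.one_def, Bicomm.add_comp]

theorem matB_unit :
    matB s φ (0 : Matrix (Fin 1) (Fin 0) R) ≫ oneB s = (zeroIso s).hom ≫ Bicomm.oneB _ :=
  powB_ext s fun j => j.elim0

theorem matB_counit :
    matB s φ (0 : Matrix (Fin 0) (Fin 1) R) ≫ (zeroIso s).hom = oneB s ≫ Bicomm.counitB _ := by
  rw [← Iso.eq_comp_inv]
  exact (powers s).hom_ext fun i => i.elim0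

theorem matB_sym : matB s φ !![0, 1; 1, 0] ≫ twoB s =
    twoB s ≫ (Bicomm.fst _ _ ≫ Bicomm.inr _ _ + Bicomm.snd _ _ ≫ Bicomm.inl _ _) := by
  refine powB_ext s fun j => ?_
  rw [reassoc_of% inclB_matB]
  fin_cases j
  · simp [inclB_one_twoB, reassoc_of% inclB_zero_twoB, End.one_def, Bicomm.zero_comp,
      Bicomm.comp_add, reassoc_of% Bicomm.inl_fst, reassoc_of% Bicomm.inl_snd]
  · simp [inclB_zero_twoB, reassoc_of% inclB_one_twoB, End.one_def, Bicomm.zero_comp,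
      Bicomm.comp_add, reassoc_of% Bicomm.inr_fst, reassoc_of% Bicomm.inr_snd]

/-- The prop functor given by a bicommutative bimonoid and an action of a semiring. -/
def matFunctor : Functor (matProp R) P where
  map {a b} A := ofHom (matB s φ (A : Matrix (Fin b) (Fin a) R)).hom
  map_comp f g := congrArg Bicomm.Hom.hom ((powers s).matMap_mul φ f g)
  map_tensor {a b c d} f g := by
    let M : Matrix (Fin (b + d)) (Fin (a + c)) R := (matOps R).tensor f g
    have h : (matB s φ M).hom ≫ (split s b d).hom =
        (split s a c).hom ≫ ((matB s φ f).hom ⊗ₘ (matB s φ g).hom) :=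
      congrArg Bicomm.Hom.hom ((powers s).matMap_tensor φ (split s a c) (split s b d)
        (inclB_split_left s a c) (inclB_split_right s a c)
        (inclB_split_left s b d) (inclB_split_right s b d) f g M rfl)
    -- Compatibility with ⊗ up to `split` becomes a strict equality, both comparison maps being
    -- identities underneath.
    rw [split_hom, split_hom] at h
    exact (Category.comp_id _).symm.trans (h.trans (Category.id_comp _))
  map_one := congrArg Bicomm.Hom.hom (matB_one s φ 0)
  map_id := (congrArg Bicomm.Hom.hom (matB_one s φ 1)).trans idPow_one
  map_sym := by
    have h := congrArg Bicomm.Hom.hom (matB_sym s φ)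
    rw [Bicomm.comp_hom, Bicomm.comp_hom, twoB_hom, Bicomm.fst_inr_add_snd_inl_hom] at h
    exact (Category.comp_id _).symm.trans (h.trans ((Category.id_comp _).trans braiding_wire))

end

end PROP

end

/-! ### From a model of the presentation to a bimonoid with endomorphism. -/

section

open CategoryTheory MonoidalCategory MonObj ComonObj

namespace PROP

variable {P : PROP.{u}} (N : Model bialgHomPresentation P)

attribute [local instance] ComonObj.instTensorUnit

namespace Model

/-- A generator of a model, as a morphism of the category. -/
def genHom {a b : ℕ} (g : BialgGen a b) : (⟨a⟩ : Obj P) ⟶ ⟨b⟩ := toHom (N.gen g)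

local notation "I" => Obj.wire P

/-- The multiplication. -/
def mu : I ⊗ I ⟶ I := N.genHom .mu
/-- The unit. -/
def eta : 𝟙_ _ ⟶ I := N.genHom .eta
/-- The comultiplication. -/
def delta : I ⟶ I ⊗ I := N.genHom .delta
/-- The counit. -/
def eps : I ⟶ 𝟙_ _ := N.genHom .eps
/-- The endomorphism. -/
def h : I ⟶ I := N.genHom .h

theorem eta_mu : N.eta ▷ I ≫ N.mu = (λ_ I).hom := by
  have := congrArg toHom (N.eqn _ _ .unit_left)
  rw [whiskerRight_wire]
  exact this.trans idPow_one.symm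

theorem eta_mu' : I ◁ N.eta ≫ N.mu = (ρ_ I).hom := by
  have := congrArg toHom (N.eqn _ _ .unit_right)
  rw [wire_whiskerLeft]
  exact this.trans idPow_one.symm

theorem mu_assoc : N.mu ▷ I ≫ N.mu = (α_ I I I).hom ≫ I ◁ N.mu ≫ N.mu := by
  have := congrArg toHom (N.eqn _ _ .assoc)
  rw [wire_whiskerLeft, whiskerRight_wire]
  exact this.trans (Category.id_comp (X := I ⊗ I ⊗ I) _).symm

theorem mu_comm : (β_ I I).hom ≫ N.mu = N.mu := by
  rw [braiding_wire]
  exact congrArg toHom (N.eqn _ _ .comm)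

theorem delta_eps : N.delta ≫ N.eps ▷ I = (λ_ I).inv := by
  have := congrArg toHom (N.eqn _ _ .counit_left)
  rw [whiskerRight_wire]
  exact this.trans idPow_one.symm

theorem delta_eps' : N.delta ≫ I ◁ N.eps = (ρ_ I).inv := by
  have := congrArg toHom (N.eqn _ _ .counit_right)
  rw [wire_whiskerLeft]
  exact this.trans idPow_one.symm

theorem delta_assoc : N.delta ≫ I ◁ N.delta = N.delta ≫ N.delta ▷ I ≫ (α_ I I I).hom := by
  have := congrArg toHom (N.eqn _ _ .coassoc)
  rw [wire_whiskerLeft, whiskerRight_wire]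
  refine this.symm.trans (congrArg (N.delta ≫ ·) ?_)
  exact (Category.comp_id (Y := I ⊗ I ⊗ I) _).symm

theorem delta_comm : N.delta ≫ (β_ I I).hom = N.delta := by
  rw [braiding_wire]
  exact congrArg toHom (N.eqn _ _ .cocomm)

/-- The symmetry of the two middle wires among four. -/
def midSwap (P : PROP.{u}) : (Obj.wire P ⊗ Obj.wire P) ⊗ Obj.wire P ⊗ Obj.wire P ⟶
    (Obj.wire P ⊗ Obj.wire P) ⊗ Obj.wire P ⊗ Obj.wire P :=
  (Obj.wire P ◁ sigma) ▷ Obj.wire P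

theorem midSwap_eq : midSwap P = toHom (P.tensor (a := 3) (b := 3) (P.tensor P.id P.sym) P.id) := by
  rw [midSwap, whiskerRight_wire, wire_whiskerLeft]
  rfl

/-- All associators between wires are identities, which leaves id ⊗ σ ⊗ id as in the bialgebra
equation. -/
theorem tensorμ_wire : tensorμ I I I I = midSwap P := by
  have h : tensorμ I I I I = ((α_ I I (I ⊗ I)).hom ≫ I ◁ (α_ I I I).inv ≫ (α_ I (I ⊗ I) I).inv) ≫
      (I ◁ sigma) ▷ I ≫ (α_ I (I ⊗ I) I).hom ≫ I ◁ (α_ I I I).hom ≫ (α_ I I (I ⊗ I)).inv := by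
    simp [tensorμ, braiding_wire]
  have h₁ : 𝟙 (I ⊗ (I ⊗ (I ⊗ I))) ≫ I ◁ 𝟙 (I ⊗ (I ⊗ I)) ≫ 𝟙 (I ⊗ (I ⊗ (I ⊗ I))) = 𝟙 _ := by simp
  rw [h]
  refine (congrArg₂ (fun k l => k ≫ (I ◁ sigma) ▷ I ≫ l) h₁ h₁).trans ?_
  exact (Category.id_comp _).trans (Category.comp_id _)

theorem mu_delta : N.mu ≫ N.delta = (N.delta ⊗ₘ N.delta) ≫ tensorμ I I I I ≫ (N.mu ⊗ₘ N.mu) := by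
  rw [tensorμ_wire]
  refine Eq.trans ?_ (Category.assoc (N.delta ⊗ₘ N.delta) (midSwap P) (N.mu ⊗ₘ N.mu))
  exact (congrArg toHom (N.eqn _ _ .delta_mu)).symm.trans
    (congrArg (fun k : (I ⊗ I) ⊗ I ⊗ I ⟶ (I ⊗ I) ⊗ I ⊗ I =>
      ((N.delta ⊗ₘ N.delta) ≫ k) ≫ (N.mu ⊗ₘ N.mu)) midSwap_eq.symm)

theorem eta_delta : N.eta ≫ N.delta = (λ_ _).inv ≫ (N.eta ⊗ₘ N.eta) :=
  (congrArg toHom (N.eqn _ _ .delta_eta)).trans (Category.id_comp _).symm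

theorem mu_eps : N.mu ≫ N.eps = (N.eps ⊗ₘ N.eps) ≫ (λ_ _).hom :=
  (congrArg toHom (N.eqn _ _ .eps_mu)).trans (Category.comp_id _).symm

theorem eta_eps : N.eta ≫ N.eps = 𝟙 _ := congrArg toHom (N.eqn _ _ .eps_eta)

theorem mu_h : N.mu ≫ N.h = (N.h ⊗ₘ N.h) ≫ N.mu := congrArg toHom (N.eqn _ _ .h_mu)

theorem eta_h : N.eta ≫ N.h = N.eta := congrArg toHom (N.eqn _ _ .h_eta)

theorem h_delta : N.h ≫ N.delta = N.delta ≫ (N.h ⊗ₘ N.h) :=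
  (congrArg toHom (N.eqn _ _ .delta_h)).symm

theorem h_eps : N.h ≫ N.eps = N.eps := congrArg toHom (N.eqn _ _ .eps_h)

/-- The bicommutative bimonoid given by a model. -/
def str : BicommStr I :=
  letI b : BimonObj I :=
    { one := N.eta
      mul := N.mu
      one_mul := N.eta_mu
      mul_one := N.eta_mu'
      mul_assoc := N.mu_assoc
      counit := N.eps
      comul := N.delta
      counit_comul := N.delta_eps
      comul_counit := N.delta_eps'
      comul_assoc := N.delta_assoc
      mul_comul := N.mu_delta
      one_comul := N.eta_delta
      mul_counit := N.mu_eps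
      one_counit := N.eta_eps }
  ⟨b, ⟨N.mu_comm⟩, ⟨N.delta_comm⟩⟩

/-- The endomorphism of the bimonoid given by a model. -/
def hB : End N.str.toBicomm :=
  Bicomm.Hom.mk (A := N.str.toBicomm) (B := N.str.toBicomm) N.h
    (isMonHom := by let := N.str.bimon; exact ⟨N.eta_h, N.mu_h⟩)
    (isComonHom := by let := N.str.bimon; exact ⟨N.h_eps, N.h_delta⟩)

/-- The action of polynomials on the bimonoid given by a model. -/
noncomputable def polyAction : Polynomial ℕ →+* End N.str.toBicomm :=
  (Polynomial.aeval N.hB).toRingHom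

theorem polyAction_X : N.polyAction Polynomial.X = N.hB := Polynomial.aeval_X _

/-- The prop functor from matrices given by a model. -/
noncomputable def functor : Functor (matProp (Polynomial ℕ)) P := matFunctor N.str N.polyAction

/-- The `matB` lemmas match each matrix with its generator up to `oneB`, `twoB` and `zeroIso`, whose
underlying morphisms are identities. -/
theorem functor_map_gen {a b : ℕ} (g : BialgGen a b) : N.functor.map g.toMatrix = N.gen g := by
  cases g with
  | mu =>
    have h := congrArg Bicomm.Hom.hom (matB_mul N.str N.polyAction)
    rw [Bicomm.comp_hom, Bicomm.comp_hom, twoB_hom, oneB_hom] at h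
    exact (Category.comp_id _).symm.trans (h.trans (Category.id_comp _))
  | eta =>
    have h := congrArg Bicomm.Hom.hom (matB_unit N.str N.polyAction)
    rw [Bicomm.comp_hom, Bicomm.comp_hom, oneB_hom] at h
    exact (Category.comp_id _).symm.trans (h.trans (Category.id_comp _))
  | delta =>
    have h := congrArg Bicomm.Hom.hom (matB_comul N.str N.polyAction)
    rw [Bicomm.comp_hom, Bicomm.comp_hom, twoB_hom, oneB_hom] at h
    exact (Category.comp_id _).symm.trans (h.trans (Category.id_comp _))
  | eps =>
    have h := congrArg Bicomm.Hom.hom (matB_counit N.str N.polyAction)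
    rw [Bicomm.comp_hom, Bicomm.comp_hom, oneB_hom] at h
    exact (Category.comp_id _).symm.trans (h.trans (Category.id_comp _))
  | h =>
    have h := congrArg Bicomm.Hom.hom (matB_scalar N.str N.polyAction Polynomial.X)
    rw [Bicomm.comp_hom, Bicomm.comp_hom, oneB_hom, polyAction_X] at h
    exact (Category.comp_id _).symm.trans (h.trans (Category.id_comp _))

end Model
end PROP

end

/-! ### Generation of all matrices by the generators. -/

section

namespace PROP

open Polynomial

variable {R : Type u} [Semiring R]

/-- The direct sum of two matrices. -/
def dsum {a b c d : ℕ} (A : Matrix (Fin b) (Fin a) R) (B : Matrix (Fin d) (Fin c) R) :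
    Matrix (Fin (b + d)) (Fin (a + c)) R := (matOps R).tensor A B

theorem dsum_apply {a b c d : ℕ} (A : Matrix (Fin b) (Fin a) R)
    (B : Matrix (Fin d) (Fin c) R) (i : Fin (b + d)) (j : Fin (a + c)) :
    dsum A B i j =
      if hi : (i : ℕ) < b then
        (if hj : (j : ℕ) < a then A ⟨i, hi⟩ ⟨j, hj⟩ else 0)
      else (if hj : (j : ℕ) < a then 0 else B ⟨i - b, by omega⟩ ⟨j - a, by omega⟩) :=
  matOps_tensor_apply A B i j

theorem dsum_one_one (m n : ℕ) :
    dsum (1 : Matrix (Fin m) (Fin m) R) (1 : Matrix (Fin n) (Fin n) R) = 1 := by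
  change Matrix.reindex _ _ (Matrix.fromBlocks 1 0 0 1) = _
  rw [Matrix.fromBlocks_one, Matrix.reindex_apply, Matrix.submatrix_one_equiv]

section

variable {a b : ℕ} (A : Matrix (Fin b) (Fin a) R)

theorem dsum_id_cast_cast (i : Fin b) (j : Fin a) :
    dsum A (1 : Matrix (Fin 1) (Fin 1) R) i.castSucc j.castSucc = A i j := by
  simp [dsum_apply]

theorem dsum_id_cast_last (i : Fin b) :
    dsum A (1 : Matrix (Fin 1) (Fin 1) R) i.castSucc (Fin.last a) = 0 := by
  simp [dsum_apply]

theorem dsum_id_last_cast (j : Fin a) :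
    dsum A (1 : Matrix (Fin 1) (Fin 1) R) (Fin.last b) j.castSucc = 0 := by
  simp [dsum_apply]

theorem dsum_id_last_last :
    dsum A (1 : Matrix (Fin 1) (Fin 1) R) (Fin.last b) (Fin.last a) = 1 := by
  simp [dsum_apply, Matrix.one_apply]

end

/-- The identity matrix with an additional last row. -/
def addRow {n : ℕ} (r : Fin n → R) : Matrix (Fin (n + 1)) (Fin n) R :=
  Matrix.of fun i j => Fin.lastCases (motive := fun _ => R) (r j)
    (fun k => (1 : Matrix (Fin n) (Fin n) R) k j) i

theorem addRow_castSucc {n : ℕ} (r : Fin n → R) (i j : Fin n) :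
    addRow r i.castSucc j = (1 : Matrix (Fin n) (Fin n) R) i j := by simp [addRow]

theorem addRow_last {n : ℕ} (r : Fin n → R) (j : Fin n) : addRow r (Fin.last n) j = r j := by
  simp [addRow]

/-- Splits off the last row: append its linear form to the inputs, then apply the other rows to the
inputs. This drives the induction on the number of rows. -/
theorem dsum_id_mul_addRow {m n : ℕ} (A : Matrix (Fin (m + 1)) (Fin n) R) :
    dsum (Matrix.of fun (i : Fin m) j => A i.castSucc j) (1 : Matrix (Fin 1) (Fin 1) R) *
      addRow (A (Fin.last m)) = A := by
  refine Matrix.ext fun i j => ?_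
  rw [Matrix.mul_apply, Fin.sum_univ_castSucc]
  induction i using Fin.lastCases with
  | last =>
    simp only [dsum_id_last_cast, dsum_id_last_last, addRow_last]
    simp
  | cast i =>
    simp only [dsum_id_cast_cast, dsum_id_cast_last, addRow_castSucc]
    simp [Matrix.one_apply]

theorem dsum_one_apply (n : ℕ) (B : Matrix (Fin 2) (Fin 2) R) (i j : Fin (n + 2)) :
    dsum (1 : Matrix (Fin n) (Fin n) R) B i j =
      if hi : (i : ℕ) < n then (if (i : ℕ) = j then 1 else 0)
        else (if hj : (j : ℕ) < n then 0 else B ⟨i - n, by omega⟩ ⟨j - n, by omega⟩) := by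
  rw [dsum_apply]
  split_ifs <;> simp_all [Matrix.one_apply]

/-- Builds the linear form one variable at a time. With y the partial sum and z the new variable,
the shear sends (y, z) to (z, y + cz), where c is the last coefficient. -/
theorem addRow_succ {n : ℕ} (r : Fin (n + 1) → R) :
    dsum (1 : Matrix (Fin n) (Fin n) R) !![0, 1; 1, r (Fin.last n)] *
      dsum (addRow fun i => r i.castSucc) (1 : Matrix (Fin 1) (Fin 1) R) = addRow r := by
  refine Matrix.ext fun i j => ?_
  refine Matrix.mul_apply.trans ?_
  refine (Fin.sum_univ_castSucc (n := n + 1) _).trans ?_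
  rw [Fin.sum_univ_castSucc]
  simp only [dsum_one_apply]
  induction j using Fin.lastCases with
  | last =>
    simp only [dsum_id_cast_last, dsum_id_last_last]
    induction i using Fin.lastCases with
    | last => simp [addRow_last]
    | cast i =>
      induction i using Fin.lastCases with
      | last => simp [addRow_castSucc]
      | cast i => simp [addRow_castSucc, Fin.ext_iff, i.2.ne]; omega
  | cast j =>
    simp only [dsum_id_cast_cast, dsum_id_last_cast]
    induction i using Fin.lastCases with
    | last => simp [addRow_last]
    | cast i =>
      induction i using Fin.lastCases with
      | last => simp [addRow_castSucc, addRow_last, Matrix.one_apply, Fin.ext_iff, j.2.ne']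
      | cast i =>
        have := i.2.ne
        simp [addRow_castSucc, addRow_last, Matrix.one_apply, Fin.val_inj, this]

/-- A class of matrices that contains the identity, the symmetry and the structure of a bimonoid,
and is closed under products and direct sums. -/
structure MatClosed (S : ∀ {n m : ℕ}, Matrix (Fin m) (Fin n) R → Prop) : Prop where
  mul : ∀ {n m k : ℕ} (A : Matrix (Fin k) (Fin m) R) (B : Matrix (Fin m) (Fin n) R),
    S A → S B → S (A * B)
  sum : ∀ {a b c d : ℕ} (A : Matrix (Fin b) (Fin a) R) (B : Matrix (Fin d) (Fin c) R),
    S A → S B → S (dsum A B)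
  one : S (1 : Matrix (Fin 0) (Fin 0) R)
  id : S (1 : Matrix (Fin 1) (Fin 1) R)
  sym : S (!![0, 1; 1, 0] : Matrix (Fin 2) (Fin 2) R)
  mu : S (!![1, 1] : Matrix (Fin 1) (Fin 2) R)
  eta : S (0 : Matrix (Fin 1) (Fin 0) R)
  delta : S (!![1; 1] : Matrix (Fin 2) (Fin 1) R)
  eps : S (0 : Matrix (Fin 0) (Fin 1) R)

theorem dsum_scalar (r s : R) : dsum !![r] !![s] = !![r, 0; 0, s] := by
  refine Matrix.ext fun i j => ?_
  rw [dsum_apply]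
  fin_cases i <;> fin_cases j <;> simp

theorem id_eq_scalar : (1 : Matrix (Fin 1) (Fin 1) R) = !![1] := by
  ext i j; fin_cases i; fin_cases j; rfl

theorem dsum_id_column (r s : R) :
    dsum (1 : Matrix (Fin 1) (Fin 1) R) !![r; s] = !![1, 0; 0, r; 0, s] := by
  refine Matrix.ext fun i j => ?_
  rw [dsum_apply]
  fin_cases i <;> fin_cases j <;> simp

theorem dsum_id_row (r s : R) :
    dsum (1 : Matrix (Fin 1) (Fin 1) R) !![r, s] = !![1, 0, 0; 0, r, s] := by
  refine Matrix.ext fun i j => ?_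
  rw [dsum_apply]
  fin_cases i <;> fin_cases j <;> simp

theorem dsum_sym_id :
    dsum !![0, 1; 1, 0] (1 : Matrix (Fin 1) (Fin 1) R) = !![0, 1, 0; 1, 0, 0; 0, 0, 1] := by
  refine Matrix.ext fun i j => ?_
  rw [dsum_apply]
  fin_cases i <;> fin_cases j <;> simp

namespace MatClosed

variable {S : ∀ {n m : ℕ}, Matrix (Fin m) (Fin n) R → Prop}

theorem identity (hS : MatClosed S) (n : ℕ) : S (1 : Matrix (Fin n) (Fin n) R) := by
  induction n with
  | zero => exact hS.one
  | succ n ih => exact dsum_one_one (R := R) n 1 ▸ hS.sum _ _ ih hS.id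

theorem scalar_zero (hS : MatClosed S) : S !![(0 : R)] := by
  have h := hS.mul _ _ hS.eta hS.eps
  convert h
  ext i j; fin_cases i; fin_cases j; simp

theorem scalar_mul (hS : MatClosed S) {r s : R} (hr : S !![r]) (hs : S !![s]) : S !![r * s] := by
  have h := hS.mul _ _ hr hs
  convert h
  simp

theorem scalar_add (hS : MatClosed S) {r s : R} (hr : S !![r]) (hs : S !![s]) : S !![r + s] := by
  have h := hS.sum _ _ hr hs
  rw [dsum_scalar] at h
  convert hS.mul _ _ (hS.mul _ _ hS.mu h) hS.delta
  simp

/-- As a circuit: (y, z) ↦ (y, z, cz) ↦ (z, y, cz) ↦ (z, y + cz), using Δ and c, then σ, then μ. -/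
theorem shear (hS : MatClosed S) {c : R} (hc : S !![c]) : S !![0, 1; 1, c] := by
  have h₁ := hS.sum _ _ hS.id hc
  rw [id_eq_scalar, dsum_scalar] at h₁
  have h₂ := hS.sum _ _ hS.id (hS.mul _ _ h₁ hS.delta)
  have h₃ : !![1, 0; 0, c] * !![(1 : R); 1] = !![1; c] := by simp
  rw [h₃, dsum_id_column] at h₂
  have h₄ := hS.sum _ _ hS.sym hS.id
  rw [dsum_sym_id] at h₄
  have h₅ := hS.sum _ _ hS.id hS.mu
  rw [dsum_id_row] at h₅
  convert hS.mul _ _ (hS.mul _ _ h₅ h₄) h₂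
  simp

/-- All matrices are generated by the bimonoid structure and the scalars. -/
theorem all (hS : MatClosed S) (h : ∀ r : R, S !![r]) {n m : ℕ} (A : Matrix (Fin m) (Fin n) R) : S A := by
  have hrow : ∀ {n : ℕ} (r : Fin n → R), S (addRow r) := by
    intro n
    induction n with
    | zero =>
      intro r
      exact (Matrix.ext fun _ j => j.elim0 : 0 = addRow r) ▸ hS.eta
    | succ n ih =>
      intro r
      exact addRow_succ r ▸ hS.mul _ _ (hS.sum _ _ (hS.identity n) (hS.shear (h _)))
        (hS.sum _ _ (ih _) hS.id)
  induction m with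
  | zero =>
    -- A matrix with no rows is a direct sum of copies of ε.
    induction n with
    | zero => exact Subsingleton.elim 1 A ▸ hS.one
    | succ n ih => exact (Matrix.ext fun i => i.elim0 :
      dsum (0 : Matrix (Fin 0) (Fin n) R) (0 : Matrix (Fin 0) (Fin 1) R) = A) ▸ hS.sum _ _ (ih 0) hS.eps
  | succ m ih =>
    exact dsum_id_mul_addRow A ▸ hS.mul _ _ (hS.sum _ _ (ih _) hS.id) (hrow _)

end MatClosed

/-- The scalars in the class are closed under sums and products and contain 0, 1 and X, which
generate ℕ[X] as a semiring. -/
theorem MatClosed.all_polynomial {S : ∀ {n m : ℕ}, Matrix (Fin m) (Fin n) (Polynomial ℕ) → Prop}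
    (hS : MatClosed S) (hX : S !![X]) {n m : ℕ} (A : Matrix (Fin m) (Fin n) (Polynomial ℕ)) :
    S A := by
  have hC : ∀ k : ℕ, S !![(C k : Polynomial ℕ)] := by
    intro k
    induction k with
    | zero => simpa using hS.scalar_zero
    | succ k ih =>
      rw [C_add]
      exact hS.scalar_add ih (by simpa [id_eq_scalar] using hS.id)
  refine hS.all (fun p => ?_) A
  induction p using Polynomial.induction_on with
  | C k => exact hC k
  | add p q hp hq => exact hS.scalar_add hp hq
  | monomial n k ih =>
    rw [pow_succ, ← mul_assoc]
    exact hS.scalar_mul ih hX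

end PROP

end

/-! ### Universal property of the prop of matrices and comparison of presented props. -/

section

namespace PROP

open Polynomial

/-! ### Functors out of the prop of matrices -/

namespace Functor

theorem map_ext {P : PROP.{u}} {Q : PROP.{v}} {F G : Functor P Q}
    (h : ∀ {a b : ℕ} (f : P.Hom a b), F.map f = G.map f) : F = G := by
  obtain ⟨mapF⟩ := F
  obtain ⟨mapG⟩ := G
  obtain rfl : @mapF = @mapG := by
    funext a b f
    exact h f
  rfl

/-- The composite of two prop functors. -/
def comp {P : PROP.{u}} {Q : PROP.{v}} {R : PROP.{w}} (G : Functor Q R) (F : Functor P Q) :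
    Functor P R where
  map f := G.map (F.map f)
  map_comp f g := by rw [F.map_comp, G.map_comp]
  map_tensor f g := by rw [F.map_tensor, G.map_tensor]
  map_one := by rw [F.map_one, G.map_one]
  map_id := by rw [F.map_id, G.map_id]
  map_sym := by rw [F.map_sym, G.map_sym]

/-- The identity prop functor. -/
def identity (P : PROP.{u}) : Functor P P where
  map f := f
  map_comp _ _ := rfl
  map_tensor _ _ := rfl
  map_one := rfl
  map_id := rfl
  map_sym := rfl

/-- The matrices on which F and G agree form a `MatClosed` class that contains X. -/
theorem ext_matProp {Q : PROP.{v}} {F G : Functor (matProp (Polynomial ℕ)) Q}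
    (h : ∀ {a b : ℕ} (g : BialgGen a b), F.map g.toMatrix = G.map g.toMatrix) : F = G := by
  have hS : MatClosed (R := Polynomial ℕ)
      (fun {n m} (A : Matrix (Fin m) (Fin n) (Polynomial ℕ)) => F.map A = G.map A) :=
    { mul := fun A B hA hB =>
        (F.map_comp A B).trans ((congrArg₂ Q.comp hA hB).trans (G.map_comp A B).symm)
      sum := fun A B hA hB =>
        (F.map_tensor A B).trans ((congrArg₂ Q.tensor hA hB).trans (G.map_tensor A B).symm)
      one := F.map_one.trans G.map_one.symm
      id := F.map_id.trans G.map_id.symm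
      sym := F.map_sym.trans G.map_sym.symm
      mu := h .mu
      eta := h .eta
      delta := h .delta
      eps := h .eps }
  exact map_ext fun A => hS.all_polynomial (h .h) A

end Functor

/-! ### The model in the prop of matrices -/

section

variable {R : Type u} [Semiring R]

theorem dsum_eta_id :
    dsum (0 : Matrix (Fin 1) (Fin 0) R) (1 : Matrix (Fin 1) (Fin 1) R) = !![0; 1] := by
  refine Matrix.ext fun i j => ?_
  rw [dsum_apply, id_eq_scalar]
  fin_cases i <;> fin_cases j <;> simp

theorem dsum_id_eta :
    dsum (1 : Matrix (Fin 1) (Fin 1) R) (0 : Matrix (Fin 1) (Fin 0) R) = !![1; 0] := by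
  refine Matrix.ext fun i j => ?_
  rw [dsum_apply, id_eq_scalar]
  fin_cases i <;> fin_cases j <;> simp

theorem dsum_eps_id :
    dsum (0 : Matrix (Fin 0) (Fin 1) R) (1 : Matrix (Fin 1) (Fin 1) R) = !![0, 1] := by
  refine Matrix.ext fun i j => ?_
  rw [dsum_apply, id_eq_scalar]
  fin_cases i; fin_cases j <;> simp

theorem dsum_id_eps :
    dsum (1 : Matrix (Fin 1) (Fin 1) R) (0 : Matrix (Fin 0) (Fin 1) R) = !![1, 0] := by
  refine Matrix.ext fun i j => ?_
  rw [dsum_apply, id_eq_scalar]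
  fin_cases i; fin_cases j <;> simp

theorem dsum_row_id (r s : R) :
    dsum !![r, s] (1 : Matrix (Fin 1) (Fin 1) R) = !![r, s, 0; 0, 0, 1] := by
  refine Matrix.ext fun i j => ?_
  rw [dsum_apply, id_eq_scalar]
  fin_cases i <;> fin_cases j <;> simp

theorem dsum_column_id (r s : R) :
    dsum !![r; s] (1 : Matrix (Fin 1) (Fin 1) R) = !![r, 0; s, 0; 0, 1] := by
  refine Matrix.ext fun i j => ?_
  rw [dsum_apply, id_eq_scalar]
  fin_cases i <;> fin_cases j <;> simp

theorem dsum_row_row (r s r' s' : R) :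
    dsum !![r, s] !![r', s'] = !![r, s, 0, 0; 0, 0, r', s'] := by
  refine Matrix.ext fun i j => ?_
  rw [dsum_apply]
  fin_cases i <;> fin_cases j <;> simp

theorem dsum_column_column (r s r' s' : R) :
    dsum !![r; s] !![r'; s'] = !![r, 0; s, 0; 0, r'; 0, s'] := by
  refine Matrix.ext fun i j => ?_
  rw [dsum_apply]
  fin_cases i <;> fin_cases j <;> simp

theorem dsum_id_sym :
    dsum (1 : Matrix (Fin 1) (Fin 1) R) !![0, 1; 1, 0] = !![1, 0, 0; 0, 0, 1; 0, 1, 0] := by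
  refine Matrix.ext fun i j => ?_
  rw [dsum_apply, id_eq_scalar]
  fin_cases i <;> fin_cases j <;> simp

theorem dsum_id_sym_id :
    dsum (!![1, 0, 0; 0, 0, 1; 0, 1, 0] : Matrix (Fin 3) (Fin 3) R)
      (1 : Matrix (Fin 1) (Fin 1) R) =
      !![1, 0, 0, 0; 0, 0, 1, 0; 0, 1, 0, 0; 0, 0, 0, 1] := by
  refine Matrix.ext fun i j => ?_
  rw [dsum_apply, id_eq_scalar]
  fin_cases i <;> fin_cases j <;> simp

end

/-- The matrices of the generators satisfy the equations. -/
theorem toMatrix_eqn {a b : ℕ} (s t : Expr BialgGen a b) (h : BialgGen.Eqn s t) :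
    eval (matProp ℕ[X]) BialgGen.toMatrix s = eval (matProp ℕ[X]) BialgGen.toMatrix t := by
  cases h with
  | unit_left =>
    have h : !![(1 : ℕ[X]), 1] * dsum (0 : Matrix (Fin 1) (Fin 0) ℕ[X]) (1 : Matrix (Fin 1) (Fin 1) ℕ[X]) =
        (1 : Matrix (Fin 1) (Fin 1) ℕ[X]) := by
      rw [dsum_eta_id, id_eq_scalar]
      simp
    exact h
  | unit_right =>
    have h : !![(1 : ℕ[X]), 1] * dsum (1 : Matrix (Fin 1) (Fin 1) ℕ[X]) (0 : Matrix (Fin 1) (Fin 0) ℕ[X]) =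
        (1 : Matrix (Fin 1) (Fin 1) ℕ[X]) := by
      rw [dsum_id_eta, id_eq_scalar]
      simp
    exact h
  | assoc =>
    have h : !![(1 : ℕ[X]), 1] * dsum !![(1 : ℕ[X]), 1] (1 : Matrix (Fin 1) (Fin 1) ℕ[X]) =
        !![(1 : ℕ[X]), 1] * dsum (1 : Matrix (Fin 1) (Fin 1) ℕ[X]) !![(1 : ℕ[X]), 1] := by
      rw [dsum_row_id, dsum_id_row]
      simp
    exact h
  | comm =>
    have h : !![(1 : ℕ[X]), 1] * !![(0 : ℕ[X]), 1; 1, 0] =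
        !![(1 : ℕ[X]), 1] := by
      simp
    exact h
  | counit_left =>
    have h : dsum (0 : Matrix (Fin 0) (Fin 1) ℕ[X]) (1 : Matrix (Fin 1) (Fin 1) ℕ[X]) * !![(1 : ℕ[X]); 1] =
        (1 : Matrix (Fin 1) (Fin 1) ℕ[X]) := by
      rw [dsum_eps_id, id_eq_scalar]
      simp
    exact h
  | counit_right =>
    have h : dsum (1 : Matrix (Fin 1) (Fin 1) ℕ[X]) (0 : Matrix (Fin 0) (Fin 1) ℕ[X]) * !![(1 : ℕ[X]); 1] =
        (1 : Matrix (Fin 1) (Fin 1) ℕ[X]) := by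
      rw [dsum_id_eps, id_eq_scalar]
      simp
    exact h
  | coassoc =>
    have h : dsum !![(1 : ℕ[X]); 1] (1 : Matrix (Fin 1) (Fin 1) ℕ[X]) * !![(1 : ℕ[X]); 1] =
        dsum (1 : Matrix (Fin 1) (Fin 1) ℕ[X]) !![(1 : ℕ[X]); 1] * !![(1 : ℕ[X]); 1] := by
      rw [dsum_column_id, dsum_id_column]
      simp
    exact h
  | cocomm =>
    have h : !![(0 : ℕ[X]), 1; 1, 0] * !![(1 : ℕ[X]); 1] =
        !![(1 : ℕ[X]); 1] := by
      simp
    exact h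
  | delta_eta => exact Matrix.ext fun _ j => j.elim0
  | eps_mu => exact Matrix.ext fun i => i.elim0
  | eps_eta => exact Matrix.ext fun i => i.elim0
  | delta_mu =>
    have h : dsum !![(1 : ℕ[X]), 1] !![(1 : ℕ[X]), 1] *
        (dsum (dsum (1 : Matrix (Fin 1) (Fin 1) ℕ[X]) !![(0 : ℕ[X]), 1; 1, 0] : Matrix (Fin 3) (Fin 3) ℕ[X]) (1 : Matrix (Fin 1) (Fin 1) ℕ[X]) *
          dsum !![(1 : ℕ[X]); 1] !![(1 : ℕ[X]); 1]) =
        !![(1 : ℕ[X]); 1] * !![(1 : ℕ[X]), 1] := by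
      rw [dsum_row_row, dsum_column_column, dsum_id_sym, dsum_id_sym_id]
      simp
    exact h
  | h_mu =>
    have h : !![(X : ℕ[X])] * !![(1 : ℕ[X]), 1] =
        !![(1 : ℕ[X]), 1] * dsum !![(X : ℕ[X])] !![(X : ℕ[X])] := by
      rw [dsum_scalar]
      simp
    exact h
  | h_eta => exact Matrix.ext fun _ j => j.elim0
  | delta_h =>
    have h : dsum !![(X : ℕ[X])] !![(X : ℕ[X])] * !![(1 : ℕ[X]); 1] =
        !![(1 : ℕ[X]); 1] * !![(X : ℕ[X])] := by
      rw [dsum_scalar]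
      simp
    exact h
  | eps_h => exact Matrix.ext fun i => i.elim0

/-- The model of the presentation in the prop of matrices. -/
noncomputable def matModel : Model bialgHomPresentation (matProp ℕ[X]) where
  gen := BialgGen.toMatrix
  eqn := toMatrix_eqn

theorem matModel_isPresentedBy : IsPresentedBy.{0, v, 0} matModel := fun _ N =>
  ⟨N.functor, N.functor_map_gen, fun _ hF =>
    Functor.ext_matProp fun g => (hF g).trans (N.functor_map_gen g).symm⟩

/-! ### Change of universe -/

end PROP

namespace PropOps

/-- A copy of the operations of a prop in a higher universe. -/
def ulift (P : PropOps.{u}) : PropOps.{max u v} where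
  Hom a b := ULift.{v} (P.Hom a b)
  comp f g := ⟨P.comp f.down g.down⟩
  tensor f g := ⟨P.tensor f.down g.down⟩
  one := ⟨P.one⟩
  id := ⟨P.id⟩
  sym := ⟨P.sym⟩

theorem ulift_cast_down {P : PropOps.{u}} {a b a' b' : ℕ} (ha : a = a') (hb : b = b')
    (f : P.ulift.Hom a b) : (P.ulift.cast ha hb f).down = P.cast ha hb f.down := by
  subst ha hb
  rfl

theorem ulift_idPow_down (P : PropOps.{u}) (n : ℕ) :
    (PropOps.idPow (ulift.{u, v} P) n).down = P.idPow n := by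
  induction n with
  | zero => rfl
  | succ n ih => exact congrArg (fun k => P.tensor k P.id) ih

theorem ulift_symPow_down (P : PropOps.{u}) (n : ℕ) :
    (PropOps.symPow (ulift.{u, v} P) n).down = P.symPow n := by
  induction n with
  | zero => rfl
  | succ n ih =>
    exact congrArg₂ (fun (k : P.Hom n n) (l : P.Hom (n + 1) (n + 1)) =>
      P.comp (P.tensor k P.sym : P.Hom (n + 2) (n + 2))
        (P.tensor l P.id : P.Hom (n + 1 + 1) (n + 1 + 1))) (ulift_idPow_down P n) ih

end PropOps

namespace PROP

open Polynomial

/-- A copy of a prop in a higher universe. -/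
def ulift (P : PROP.{u}) : PROP.{max u v} where
  toPropOps := PropOps.ulift.{u, v} P.toPropOps
  comp_assoc f g h := ULift.ext _ _ (P.comp_assoc f.down g.down h.down)
  tensor_assoc f g h := ULift.ext _ _
    ((PropOps.ulift_cast_down _ _ _).trans (P.tensor_assoc f.down g.down h.down))
  comp_tensor_comp f g h k := ULift.ext _ _
    (P.comp_tensor_comp f.down g.down h.down k.down)
  tensor_one f := ULift.ext _ _ (P.tensor_one f.down)
  one_tensor f := ULift.ext _ _ ((PropOps.ulift_cast_down _ _ _).trans (P.one_tensor f.down))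
  comp_idPow {a _} f := ULift.ext _ _
    ((congrArg (P.comp f.down) (PropOps.ulift_idPow_down _ a)).trans (P.comp_idPow f.down))
  idPow_comp {_ b} f := ULift.ext _ _
    ((congrArg (P.comp · f.down) (PropOps.ulift_idPow_down _ b)).trans (P.idPow_comp f.down))
  sym_comp_sym := ULift.ext _ _ (P.sym_comp_sym.trans (PropOps.ulift_idPow_down _ 2).symm)
  sym_natural {a b} f := ULift.ext _ _
    ((congrArg₂ P.comp (PropOps.ulift_symPow_down _ b) (PropOps.ulift_cast_down _ _ _)).trans
      ((P.sym_natural f.down).trans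
        (congrArg (P.comp (P.tensor f.down P.id)) (PropOps.ulift_symPow_down _ a).symm)))

namespace Functor

/-- The functor to the copy of a prop. -/
def up (P : PROP.{u}) : Functor P (ulift.{u, v} P) where
  map f := ⟨f⟩
  map_comp _ _ := rfl
  map_tensor _ _ := rfl
  map_one := rfl
  map_id := rfl
  map_sym := rfl

/-- The functor from the copy of a prop. -/
def down (P : PROP.{u}) : Functor (ulift.{u, v} P) P where
  map f := f.down
  map_comp _ _ := rfl
  map_tensor _ _ := rfl
  map_one := rfl
  map_id := rfl
  map_sym := rfl

/-- Prop functors commute with the evaluation of expressions. -/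
theorem map_eval {P : PROP.{u}} {Q : PROP.{v}} (F : Functor P Q) {G : ℕ → ℕ → Type w}
    (γ : {a b : ℕ} → G a b → P.Hom a b) {a b : ℕ} (s : Expr G a b) :
    F.map (eval P γ s) = eval Q (fun g => F.map (γ g)) s := by
  induction s with
  | gen g => rfl
  | comp f g hf hg => exact (F.map_comp _ _).trans (congrArg₂ Q.comp hf hg)
  | tensor f g hf hg => exact (F.map_tensor _ _).trans (congrArg₂ Q.tensor hf hg)
  | one => exact F.map_one
  | id => exact F.map_id
  | sym => exact F.map_sym

end Functor

/-- The image of a model under a prop functor. -/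
def Model.map {S : Presentation.{w}} {P : PROP.{u}} {Q : PROP.{v}} (M : Model S P)
    (F : Functor P Q) : Model S Q where
  gen g := F.map (M.gen g)
  eqn s t h := by
    rw [← F.map_eval, ← F.map_eval, M.eqn s t h]

/-- Every prop presented by the generators and equations is isomorphic to the prop of matrices. -/
theorem exists_iso_matProp {P : PROP.{u}} (N : Model bialgHomPresentation P)
    (hN : IsPresentedBy.{u, u, 0} N) :
    ∃ F : Iso P (matProp ℕ[X]), ∀ {a b : ℕ} (g : BialgGen a b),
      F.hom.map (N.gen g) = g.toMatrix := by
  -- The universal property of P only concerns props in its own universe, while matrices live in the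
  -- lowest one; hence the lifted copy.
  obtain ⟨F, hF, -⟩ := hN (ulift.{0, u} (matProp ℕ[X])) (matModel.map (Functor.up _))
  let F' : Functor P (matProp ℕ[X]) := (Functor.down _).comp F
  have hF' : ∀ {a b : ℕ} (g : BialgGen a b), F'.map (N.gen g) = g.toMatrix := fun g =>
    congrArg ULift.down (hF g)
  -- Both endofunctors of P fix the generators, so they agree by the uniqueness in its universal
  -- property.
  have h₁ : N.functor.comp F' = Functor.identity P :=
    (hN P N).unique
      (fun g => (congrArg N.functor.map (hF' g)).trans (N.functor_map_gen g)) (fun _ => rfl)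
  have h₂ : F'.comp N.functor = Functor.identity (matProp ℕ[X]) :=
    Functor.ext_matProp fun g => (congrArg F'.map (N.functor_map_gen g)).trans (hF' g)
  exact ⟨⟨F', N.functor, fun f => congrArg (fun K : Functor P P => K.map f) h₁,
    fun A => congrArg (fun K : Functor (matProp ℕ[X]) (matProp ℕ[X]) => K.map A) h₂⟩, hF'⟩

end PROP

end

theorem mainTheorem11 :
    ∃ M : PROP.Model PROP.bialgHomPresentation (PROP.matProp (Polynomial ℕ)),
      (∀ {a b : ℕ} (g : PROP.BialgGen a b), M.gen g = g.toMatrix) ∧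
      PROP.IsPresentedBy.{0, u, 0} M ∧
      ∀ (P : PROP.{u}) (N : PROP.Model PROP.bialgHomPresentation P),
        PROP.IsPresentedBy.{u, u, 0} N →
        ∃ F : PROP.Iso P (PROP.matProp (Polynomial ℕ)),
          ∀ {a b : ℕ} (g : PROP.BialgGen a b), F.hom.map (N.gen g) = g.toMatrix :=
  ⟨PROP.matModel, fun _ => rfl, PROP.matModel_isPresentedBy, fun _ N hN =>
    PROP.exists_iso_matProp N hN⟩
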